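/- Write $\hat f$ for the Fourier transform of a tempered distribution, with phase $e^{-ix\xi}$ on $\mathbb R$ and $e^{-i(x\xi+t\lambda)}$ on $\mathbb R^2$, and let $\|g\|_{H^{s}(\mathbb R)}=\bigl(\int(1+|\xi|)^{2s}|\hat g(\xi)|^2\,d\xi\bigr)^{1/2}$. Fix $\tfrac12<\alpha<\tfrac23$ and $0<b<\tfrac12$. The modified Bourgain space $X_b$ consists of the tempered distributions $f\in\mathcal S'(\mathbb R^2)$ whose Fourier transform is a function and for which $$\|f\|_{X_b}=\Bigl(\iint(1+|\lambda-\xi^3|)^{2b}|\hat f(\xi,\lambda)|^2\,d\xi\,d\lambda\Bigr)^{1/2}+\Bigl(\iint_{|\xi|<1}(1+|\lambda|)^{2\alpha}|\hat f(\xi,\lambda)|^2\,d\xi\,d\lambda\Bigr)^{1/2}<\infty .$$ Let $S(t)$ be the solution operator of $\partial_tw+\partial_x^3w=0$ on $\mathbb R$, that is, the Fourier multiplier $\widehat{S(t)\phi}(\xi)=e^{it\xi^3}\hat\phi(\xi)$, and let $\delta_0$ be the Dirac mass at $x=0$. For $\theta\in C_0^\infty(\mathbb R)$ and $g\in H^{-1/3}(\mathbb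 R)$, the Duhamel boundary forcing term $$u(x,t)=\theta(t)\int_0^tS(t-t')\delta_0(x)\,g(t')\,dt'$$ is understood as the distribution on $\mathbb R^2$ given by $\langle u,\psi\rangle=\langle g,\Phi_\psi\rangle$ for $\psi\in\mathcal S(\mathbb R^2)$, where $\langle\cdot,\cdot\rangle$ on the right is the bilinear pairing of $H^{-1/3}(\mathbb R)$ and $H^{1/3}(\mathbb R)$ extending $\int g\Phi\,ds$, and $\Phi_\psi(s)=\int_s^\infty\theta(t)\langle S(t-s)\delta_0,\psi(\cdot,t)\rangle\,dt$ for $s>0$, $\Phi_\psi(s)=-\int_{-\infty}^s\theta(t)\langle S(t-s)\delta_0,\psi(\cdot,t)\rangle\,dt$ for $s<0$. **Lemma 5.3.** Let $\theta\in C_0^\infty(\mathbb R)$. There is a constant $C$, depending only on $\alpha$, $b$ and $\theta$, such that for every $g\in H^{-1/3}(\mathbb R)$ the above term is a well-defined tempered distribution on $\mathbb R^2$, belongs to $X_b$, and satisfies $$\Bigl\|\theta(t)\int_0^tS(t-t')\delta_0(x)\,g(t')\,dt'\Bigr\|_{X_b}\le C\,\|g\|_{H^{-1/3}(\mathbb R)}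 .$$ -/

import Mathlib

open MeasureTheory FourierTransform
open scoped SchwartzMap ENNReal NNReal ContDiff

namespace BoundaryForcing

noncomputable section

/-- The space-time plane. Coordinate `0` is the space variable `x` (dual variable `ξ`),
coordinate `1` is the time variable `t` (dual variable `λ`). -/
abbrev Plane : Type := EuclideanSpace ℝ (Fin 2)

/-! ### Tempered distributions given by functions, and Fourier transforms -/

section Represents

variable {E : Type*} [NormedAddCommGroup E] [InnerProductSpace ℝ E] [FiniteDimensional ℝ E]
  [MeasurableSpace E] [BorelSpace E]

/-- The tempered distribution `f` is the locally integrable function `F`. -/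
def IsGivenBy (f : 𝓢'(E, ℂ)) (F : E → ℂ) : Prop :=
  LocallyIntegrable F ∧
    ∀ φ : 𝓢(E, ℂ), Integrable (fun x => φ x * F x) ∧ f φ = ∫ x, φ x * F x

theorem IsGivenBy.ae_eq {f : 𝓢'(E, ℂ)} {F₁ F₂ : E → ℂ} (h₁ : IsGivenBy f F₁)
    (h₂ : IsGivenBy f F₂) : F₁ =ᵐ[volume] F₂ := by
  refine ae_eq_of_integral_contDiff_smul_eq h₁.1 h₂.1 fun φ hφ hφc => ?_
  have hc : HasCompactSupport (Complex.ofRealCLM ∘ φ) := hφc.comp_left rfl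
  have hs : ContDiff ℝ ∞ (Complex.ofRealCLM ∘ φ) := by fun_prop
  have e₁ := (h₁.2 (hc.toSchwartzMap hs)).2
  have e₂ := (h₂.2 (hc.toSchwartzMap hs)).2
  simpa using e₁.symm.trans e₂

/-- The Fourier transform of `f`, in the convention `f̂(ξ) = ∫ e^{-i⟨x, ξ⟩} f(x) dx`, is the
locally integrable function `F`. Mathlib's `𝓕` uses the phase `e^{-2πi⟨x, ξ⟩}`, so that
`(𝓕 f)(ξ) = f̂(2πξ)`. -/
def HasFourierTransform (f : 𝓢'(E, ℂ)) (F : E → ℂ) : Prop :=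
  IsGivenBy (𝓕 f) (fun ξ => F ((2 * Real.pi) • ξ))

end Represents

/-- The norm of `H^s(ℝ)`: `(∫ (1 + |ξ|)^{2s} |ĝ(ξ)|² dξ)^{1/2}`. It is `∞` if `ĝ` is not a function;
otherwise `ĝ` is unique almost everywhere and the infimum is over equal values. -/
def sobolevENorm (s : ℝ) (g : 𝓢'(ℝ, ℂ)) : ℝ≥0∞ :=
  ⨅ (G : ℝ → ℂ) (_ : HasFourierTransform g G),
    (∫⁻ ξ, ENNReal.ofReal ((1 + |ξ|) ^ (2 * s)) * ‖G ξ‖ₑ ^ 2) ^ (1 / 2 : ℝ)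

/-- The norm of the modified Bourgain space `X_b`, with low-frequency exponent `α`:
`(∫∫ (1 + |λ - ξ³|)^{2b} |f̂(ξ, λ)|² dξ dλ)^{1/2}
  + (∫∫_{|ξ| < 1} (1 + |λ|)^{2α} |f̂(ξ, λ)|² dξ dλ)^{1/2}`.
It is `∞` if `f̂` is not a function; otherwise `f̂` is unique almost everywhere and the infimum is
over equal values. -/
def bourgainENorm (α b : ℝ) (f : 𝓢'(Plane, ℂ)) : ℝ≥0∞ :=
  ⨅ (F : Plane → ℂ) (_ : HasFourierTransform f F),
    (∫⁻ z, ENNReal.ofReal ((1 + |z 1 - z 0 ^ 3|) ^ (2 * b)) * ‖F z‖ₑ ^ 2) ^ (1 / 2 : ℝ) +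
    (∫⁻ z in {z : Plane | |z 0| < 1},
      ENNReal.ofReal ((1 + |z 1|) ^ (2 * α)) * ‖F z‖ₑ ^ 2) ^ (1 / 2 : ℝ)

/-- Membership in the modified Bourgain space `X_b`. -/
def MemBourgain (α b : ℝ) (f : 𝓢'(Plane, ℂ)) : Prop :=
  bourgainENorm α b f < ⊤

/-! ### The Airy group -/

/-- `S(t)` is the Fourier multiplier `e^{itξ³}`, the solution operator of `∂ₜw + ∂ₓ³w = 0`.
In the frequency variable of Mathlib's Fourier transform the symbol is `e^{it(2πξ)³}`. -/
def airySymbol (t ξ : ℝ) : ℂ :=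
  Complex.exp (Complex.I * ((t * (2 * Real.pi * ξ) ^ 3 : ℝ) : ℂ))

theorem hasTemperateGrowth_airySymbol (t : ℝ) : (airySymbol t).HasTemperateGrowth := by
  have hder : ∀ n : ℕ, iteratedDeriv n (fun x : ℝ => Complex.exp (Complex.I * (x : ℂ))) =
      fun x : ℝ => Complex.I ^ n * Complex.exp (Complex.I * (x : ℂ)) := by
    intro n
    induction n with
    | zero => simp
    | succ n ih =>
      rw [iteratedDeriv_succ, ih]
      funext x
      have h1 : HasDerivAt (fun y : ℝ => Complex.I * (y : ℂ)) (Complex.I * 1) x :=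
        (Complex.ofRealCLM.hasDerivAt (x := x)).const_mul Complex.I
      have h2 := (h1.cexp).const_mul (Complex.I ^ n)
      rw [h2.deriv]
      ring
  have hexp : (fun x : ℝ => Complex.exp (Complex.I * (x : ℂ))).HasTemperateGrowth := by
    refine ⟨?_, fun n => ⟨0, 1, fun x => ?_⟩⟩
    · exact Complex.contDiff_exp.comp (contDiff_const.mul Complex.ofRealCLM.contDiff)
    · rw [norm_iteratedFDeriv_eq_norm_iteratedDeriv, hder n]
      have hone : ‖Complex.exp (Complex.I * (x : ℂ))‖ = 1 := by
        rw [mul_comm, Complex.norm_exp_ofReal_mul_I]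
      simp [hone]
  have hpoly : (fun ξ : ℝ => t * (2 * Real.pi * ξ) ^ 3).HasTemperateGrowth := by
    fun_prop
  exact hexp.comp hpoly

/-- The group `S(t)` on tempered distributions. -/
def airyGroup (t : ℝ) : 𝓢'(ℝ, ℂ) →L[ℂ] 𝓢'(ℝ, ℂ) :=
  TemperedDistribution.fourierMultiplierCLM ℂ (airySymbol t)

/-! ### The Duhamel boundary forcing term -/

theorem isometry_horizontal (t : ℝ) : Isometry (fun x : ℝ => (!₂[x, t] : Plane)) := by
  refine Isometry.of_dist_eq fun x y => ?_
  simp [EuclideanSpace.dist_eq, Real.dist_eq, Real.sqrt_sq_eq_abs]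

theorem hasTemperateGrowth_horizontal (t : ℝ) :
    (fun x : ℝ => (!₂[x, t] : Plane)).HasTemperateGrowth := by
  have h : (fun x : ℝ => (!₂[x, t] : Plane)) =
      fun x => x • (!₂[1, 0] : Plane) + (!₂[0, t] : Plane) := by
    funext x
    ext i
    fin_cases i <;> simp
  rw [h]
  fun_prop

/-- The restriction `ψ(·, t)` of a space-time test function to the time `t`. -/
def timeSlice (t : ℝ) : 𝓢(Plane, ℂ) →L[ℂ] 𝓢(ℝ, ℂ) :=
  SchwartzMap.compCLMOfAntilipschitz ℂ (hasTemperateGrowth_horizontal t)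
    (isometry_horizontal t).antilipschitz

/-- The function `s ↦ Φ(s)` that the distribution `g` is paired with when
`θ(t) ∫₀ᵗ S(t - s) δ₀(x) g(s) ds` is tested against `ψ(x, t)`. Integrating
`∫ θ(t) (∫₀ᵗ g(s) ⟨S(t - s) δ₀, ψ(·, t)⟩ ds) dt` over `t` first gives `∫ g(s) Φ(s) ds`; the sign for
negative `s` comes from `∫₀ᵗ = -∫ₜ⁰`. `Φ` has compact support and is smooth up to a jump at `0`,
so it belongs to `H^{1/3}(ℝ)`. -/
def forcingTranspose (θ : ℝ → ℂ) (ψ : 𝓢(Plane, ℂ)) (s : ℝ) : ℂ :=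
  if 0 < s then
    ∫ t in Set.Ioi s,
      θ t * airyGroup (t - s) (TemperedDistribution.delta (0 : ℝ)) (timeSlice t ψ)
  else
    -∫ t in Set.Iio s,
      θ t * airyGroup (t - s) (TemperedDistribution.delta (0 : ℝ)) (timeSlice t ψ)

/-- The space-time distribution `u` is `θ(t) ∫₀ᵗ S(t - s) δ₀(x) g(s) ds`: for every test function
`ψ`, `⟨u, ψ⟩` is the duality pairing `⟨g, Φ⟩ = ∫ (𝓕 g)(τ) (𝓕⁻ Φ)(τ) dτ` of `H^{-1/3}(ℝ)` and
`H^{1/3}(ℝ)`, which extends `∫ g(s) Φ(s) ds`; here `Φ = forcingTranspose θ ψ`. -/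
def IsForcingTerm (θ : ℝ → ℂ) (g : 𝓢'(ℝ, ℂ)) (u : 𝓢'(Plane, ℂ)) : Prop :=
  ∃ G : ℝ → ℂ, IsGivenBy (𝓕 g) G ∧ ∀ ψ : 𝓢(Plane, ℂ),
    Integrable (fun τ => G τ * 𝓕⁻ (forcingTranspose θ ψ) τ) ∧
      u ψ = ∫ τ, G τ * 𝓕⁻ (forcingTranspose θ ψ) τ

theorem IsForcingTerm.unique {θ : ℝ → ℂ} {g : 𝓢'(ℝ, ℂ)} {u₁ u₂ : 𝓢'(Plane, ℂ)}
    (h₁ : IsForcingTerm θ g u₁) (h₂ : IsForcingTerm θ g u₂) : u₁ = u₂ := by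
  obtain ⟨G₁, hG₁, h₁⟩ := h₁
  obtain ⟨G₂, hG₂, h₂⟩ := h₂
  ext ψ
  rw [(h₁ ψ).2, (h₂ ψ).2]
  refine integral_congr_ae ?_
  filter_upwards [hG₁.ae_eq hG₂] with τ hτ
  rw [hτ]

end

end BoundaryForcing

namespace BoundaryForcing

noncomputable section

/-! ### The Fourier transform on `L²`: agreement with the integral transform, and Plancherel. -/

section

variable {E : Type*} [NormedAddCommGroup E] [InnerProductSpace ℝ E] [FiniteDimensional ℝ E]
  [MeasurableSpace E] [BorelSpace E]

/-! In Mathlib's normalization put `G = 𝓕 g`, `Θ = 𝓕 θ` and `ρ = dispersion ξ`. For a datum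
`e^{2πisτ}` the Duhamel integral at spatial frequency `ξ` is `θ(t) (e^{2πitτ} - e^{2πitρ}) / (2πi(τ
- ρ))`. Its transform in `t` is `forcingKernel`, so the transform of `u` is `∫ G(τ) (Θ(l-τ) -
Θ(l-ρ)) / (2πi(τ-ρ)) dτ`, which is `forcingSymbol`. The numerator vanishes at `τ = ρ`, and no
principal value is needed.

The kernel is split as `-Θ(l-ρ) H(τ-ρ)` plus a remainder, where `H = hilbertKernel` agrees with
`1/(2πiσ)` to leading order at infinity but is bounded. The remainder is `O(⟨l-ρ⟩⁻¹ ⟨l-τ⟩⁻³)`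
(`exists_norm_forcingKernel_add_le`), where `⟨x⟩ = 1 + |x|`.

The first piece is a cut-off free Airy evolution with datum `hilbertOp G (dispersion ξ)`. The
substitution `ρ = dispersion ξ` turns `dξ` into essentially `⟨ρ⟩^{-2/3} dρ` for `|ξ| ≥ 1`, which is
exactly the `H^{-1/3}` weight. It remains to bound the regularized Hilbert transform on
`L²(⟨ρ⟩^{-2/3} dρ)` (`lintegral_bracketPow_mul_enorm_hilbertOp_sq_le`): the unweighted bound is
Plancherel, and the commutator with the weight is dominated by a Hardy-type kernel, to which Schur's
test applies.

For the remainder, the `ξ`-integral of `⟨l-ρ⟩^{2b-2}` is `O(⟨l⟩^{-2/3})`, since `2 - 2b > 1`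
(`exists_lintegral_bracketPow_sub_dispersion_le`), and convolution with `⟨τ⟩⁻³` preserves the
weighted space. If `|ξ| < 1`, then `ρ` is bounded and `⟨l⟩^{2α-2} ≤ ⟨l⟩^{-2/3}`, since `α ≤ 2/3`.

The case `b = 0` puts the symbol in `L²(ℝ²)`, so `u` can be defined as its inverse transform. Fubini
identifies this `u` with the transposed pairing (`fourierInv_forcingTranspose`,
`exists_isForcingTerm`). -/

theorem isGivenBy_toTemperedDistribution (f : Lp ℂ 2 (volume : Measure E)) :
    IsGivenBy (f : 𝓢'(E, ℂ)) f := by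
  refine ⟨(Lp.memLp f).locallyIntegrable (by norm_num), fun φ => ⟨?_, ?_⟩⟩
  · exact (φ.memLp 2 volume).integrable_mul (Lp.memLp f)
  · simp [Lp.toTemperedDistribution_apply]

theorem lintegral_enorm_sq_eq_eLpNorm (f : E → ℂ) :
    ∫⁻ x, ‖f x‖ₑ ^ 2 = eLpNorm f 2 volume ^ 2 := by
  rw [eLpNorm_eq_lintegral_rpow_enorm_toReal (by norm_num) (by norm_num)]
  rw [← ENNReal.rpow_natCast, ← ENNReal.rpow_mul]
  norm_num

/-- On integrable square-integrable functions, the `L²` Fourier transform is the integral one. -/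
theorem fourier_toLp_ae_eq {h : E → ℂ} (h₁ : Integrable h) (h₂ : MemLp h 2 volume) :
    (𝓕 (h₂.toLp h) : Lp ℂ 2 (volume : Measure E)) =ᵐ[volume] 𝓕 h := by
  have hc : Continuous (𝓕 h) := VectorFourier.fourierIntegral_continuous
    Real.continuous_fourierChar continuous_inner h₁
  -- Both functions represent the same tempered distribution: for the integral transform, the
  -- transform is moved onto the test function.
  refine IsGivenBy.ae_eq (isGivenBy_toTemperedDistribution _)
    ⟨hc.locallyIntegrable, fun φ => ⟨?_, ?_⟩⟩
  · refine φ.integrable.mul_bdd (c := ∫ x, ‖h x‖) hc.aestronglyMeasurable (ae_of_all _ fun x => ?_)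
    exact VectorFourier.norm_fourierIntegral_le_integral_norm _ _ _ _ _
  · rw [← Lp.fourier_toTemperedDistribution_eq, TemperedDistribution.fourier_apply,
      Lp.toTemperedDistribution_apply]
    have := VectorFourier.integral_fourierIntegral_smul_eq_flip (μ := (volume : Measure E))
      (ν := (volume : Measure E)) (L := innerₗ E)
      Real.continuous_fourierChar continuous_inner φ.integrable h₁
    rw [flip_innerₗ] at this
    refine Eq.trans (integral_congr_ae ?_) this
    filter_upwards [h₂.coeFn_toLp] with x hx
    rw [hx]
    rfl

/-- Plancherel's theorem for integrable square-integrable functions. -/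
theorem lintegral_enorm_sq_fourier {h : E → ℂ} (h₁ : Integrable h) (h₂ : MemLp h 2 volume) :
    ∫⁻ x, ‖𝓕 h x‖ₑ ^ 2 = ∫⁻ x, ‖h x‖ₑ ^ 2 := by
  have e : ‖(𝓕 (h₂.toLp h) : Lp ℂ 2 (volume : Measure E))‖ₑ = ‖h₂.toLp h‖ₑ := by
    rw [enorm_eq_iff_norm_eq, Lp.norm_fourier_eq]
  rw [lintegral_enorm_sq_eq_eLpNorm, lintegral_enorm_sq_eq_eLpNorm,
    ← eLpNorm_congr_ae (fourier_toLp_ae_eq h₁ h₂), ← Lp.enorm_def, e, Lp.enorm_toLp]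

theorem lintegral_enorm_sq_fourierInv {h : E → ℂ} (h₁ : Integrable h) (h₂ : MemLp h 2 volume) :
    ∫⁻ x, ‖𝓕⁻ h x‖ₑ ^ 2 = ∫⁻ x, ‖h x‖ₑ ^ 2 := by
  rw [← lintegral_enorm_sq_fourier h₁ h₂, ← lintegral_neg_eq_self]
  simp [Real.fourierInv_eq_fourier_neg]

end

/-! ### Cauchy–Schwarz and Schur's test for nonnegative kernels. -/

/-- The Cauchy–Schwarz inequality. -/
theorem lintegral_mul_sq_le {α : Type*} [MeasurableSpace α] {μ : Measure α} {f g : α → ℝ≥0∞}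
    (hf : AEMeasurable f μ) (hg : AEMeasurable g μ) :
    (∫⁻ x, f x * g x ∂μ) ^ 2 ≤ (∫⁻ x, f x ^ 2 ∂μ) * ∫⁻ x, g x ^ 2 ∂μ := by
  have h := ENNReal.lintegral_mul_le_Lp_mul_Lq μ (p := 2) (q := 2)
    (by constructor <;> norm_num) hf hg
  have e3 : ∀ a : ℝ≥0∞, (a ^ (1 / 2 : ℝ)) ^ 2 = a := fun a => by
    rw [← ENNReal.rpow_natCast, ← ENNReal.rpow_mul]; norm_num
  have h2 := pow_le_pow_left' h 2
  rw [mul_pow, e3, e3] at h2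
  simpa using h2

/-- Schur's test. -/
theorem lintegral_sq_lintegral_mul_le_of_schur {α β : Type*} [MeasurableSpace α]
    [MeasurableSpace β] {μ : Measure α} {ν : Measure β} [SFinite μ] [SFinite ν]
    {K : α → β → ℝ≥0∞} (hK : Measurable (Function.uncurry K)) {p : α → ℝ≥0∞} {q : β → ℝ≥0∞}
    (hp : Measurable p) (hq : Measurable q) (hq0 : ∀ y, q y ≠ 0) (hqt : ∀ y, q y ≠ ⊤)
    {A B : ℝ≥0∞} (hA : ∀ x, ∫⁻ y, K x y * q y ∂ν ≤ A * p x)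
    (hB : ∀ y, ∫⁻ x, K x y * p x ∂μ ≤ B * q y) {f : β → ℝ≥0∞} (hf : AEMeasurable f ν) :
    ∫⁻ x, (∫⁻ y, K x y * f y ∂ν) ^ 2 ∂μ ≤ A * B * ∫⁻ y, f y ^ 2 ∂ν := by
  wlog hfm : Measurable f generalizing f
  · have h := this hf.measurable_mk.aemeasurable hf.measurable_mk
    have e : ∀ x, ∫⁻ y, K x y * f y ∂ν = ∫⁻ y, K x y * hf.mk f y ∂ν := fun x =>
      lintegral_congr_ae (by filter_upwards [hf.ae_eq_mk] with y hy; rw [hy])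
    have e' : ∫⁻ y, f y ^ 2 ∂ν = ∫⁻ y, hf.mk f y ^ 2 ∂ν :=
      lintegral_congr_ae (by filter_upwards [hf.ae_eq_mk] with y hy; rw [hy])
    simpa only [e, e'] using h
  have hKx : ∀ x, Measurable (K x) := fun x => hK.comp (by fun_prop : Measurable fun y => (x, y))
  have hKy : ∀ y, Measurable (fun x => K x y) := fun y =>
    hK.comp (by fun_prop : Measurable fun x => (x, y))
  -- Cauchy–Schwarz for the factorization `K f = (K q)^{1/2} (K q⁻¹ f²)^{1/2}`; the first factor is
  -- controlled by `hA`.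
  have hCS : ∀ x, (∫⁻ y, K x y * f y ∂ν) ^ 2 ≤
      A * p x * ∫⁻ y, K x y * ((q y)⁻¹ * f y ^ 2) ∂ν := by
    intro x
    have h := lintegral_mul_sq_le (μ := ν) (f := fun y => (K x y * q y) ^ (1 / 2 : ℝ))
      (g := fun y => (K x y * ((q y)⁻¹ * f y ^ 2)) ^ (1 / 2 : ℝ))
      (by have := hKx x; fun_prop) (by have := hKx x; fun_prop)
    have e : ∀ y, (K x y * q y) ^ (1 / 2 : ℝ) * (K x y * ((q y)⁻¹ * f y ^ 2)) ^ (1 / 2 : ℝ) =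
        K x y * f y := by
      intro y
      rw [← ENNReal.mul_rpow_of_nonneg _ _ (by norm_num)]
      have : K x y * q y * (K x y * ((q y)⁻¹ * f y ^ 2)) = (K x y * f y) ^ (2 : ℝ) := by
        rw [show K x y * q y * (K x y * ((q y)⁻¹ * f y ^ 2)) =
          (q y * (q y)⁻¹) * (K x y * f y) ^ 2 by ring, ENNReal.mul_inv_cancel (hq0 y) (hqt y),
          one_mul]
        norm_cast
      rw [this, ← ENNReal.rpow_mul]
      norm_num
    have e2 : ∀ a : ℝ≥0∞, (a ^ (1 / 2 : ℝ)) ^ 2 = a := fun a => by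
      rw [← ENNReal.rpow_natCast, ← ENNReal.rpow_mul]; norm_num
    simp only [e, e2] at h
    exact h.trans (by gcongr; exact hA x)
  calc ∫⁻ x, (∫⁻ y, K x y * f y ∂ν) ^ 2 ∂μ
      ≤ ∫⁻ x, A * p x * ∫⁻ y, K x y * ((q y)⁻¹ * f y ^ 2) ∂ν ∂μ := lintegral_mono hCS
    _ = ∫⁻ x, ∫⁻ y, A * p x * (K x y * ((q y)⁻¹ * f y ^ 2)) ∂ν ∂μ := by
      refine lintegral_congr fun x => ?_
      rw [lintegral_const_mul]
      have := hKx x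
      fun_prop
    _ = ∫⁻ y, ∫⁻ x, A * p x * (K x y * ((q y)⁻¹ * f y ^ 2)) ∂μ ∂ν := by
      refine lintegral_lintegral_swap (Measurable.aemeasurable ?_)
      exact (measurable_const.mul (hp.comp measurable_fst)).mul
        (hK.mul ((hq.inv.mul (hfm.pow_const _)).comp measurable_snd))
    _ = ∫⁻ y, A * ((q y)⁻¹ * f y ^ 2) * ∫⁻ x, K x y * p x ∂μ ∂ν := by
      refine lintegral_congr fun y => ?_
      rw [← lintegral_const_mul _ (by have := hKy y; fun_prop)]
      exact lintegral_congr fun x => by ring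
    _ ≤ ∫⁻ y, A * B * f y ^ 2 ∂ν := by
      refine lintegral_mono fun y => ?_
      calc A * ((q y)⁻¹ * f y ^ 2) * ∫⁻ x, K x y * p x ∂μ
          ≤ A * ((q y)⁻¹ * f y ^ 2) * (B * q y) := by gcongr; exact hB y
        _ = (q y * (q y)⁻¹) * (A * B * f y ^ 2) := by ring
        _ = A * B * f y ^ 2 := by rw [ENNReal.mul_inv_cancel (hq0 y) (hqt y), one_mul]
    _ = A * B * ∫⁻ y, f y ^ 2 ∂ν := lintegral_const_mul _ (hfm.pow_const _)

/-! ### The weight `1 + |x|` -/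

/-- The weight `1 + |x|`. -/
def bracket (x : ℝ) : ℝ := 1 + |x|

theorem one_le_bracket (x : ℝ) : 1 ≤ bracket x := by
  simp [bracket]

theorem bracket_pos (x : ℝ) : 0 < bracket x := one_pos.trans_le (one_le_bracket x)

@[fun_prop]
theorem continuous_bracket : Continuous bracket := by
  unfold bracket; fun_prop

@[fun_prop]
theorem measurable_bracket : Measurable bracket := continuous_bracket.measurable

theorem bracket_neg (x : ℝ) : bracket (-x) = bracket x := by simp [bracket]

theorem bracket_sub_comm (x y : ℝ) : bracket (x - y) = bracket (y - x) := by
  simp [bracket, abs_sub_comm]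

theorem bracket_add_le (x y : ℝ) : bracket (x + y) ≤ bracket x * bracket y := by
  unfold bracket
  nlinarith [abs_add_le x y, abs_nonneg x, abs_nonneg y, mul_nonneg (abs_nonneg x) (abs_nonneg y)]

theorem bracket_le_mul_bracket_sub (x y : ℝ) : bracket x ≤ bracket (x - y) * bracket y := by
  simpa using bracket_add_le (x - y) y

theorem integrable_bracket_rpow {r : ℝ} (hr : r < -1) :
    Integrable (fun x => bracket x ^ r) := by
  have := integrable_one_add_norm (E := ℝ) (μ := volume) (r := -r) (by simp; linarith)
  simpa [bracket] using this

theorem lintegral_bracket_rpow_lt_top {r : ℝ} (hr : r < -1) :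
    ∫⁻ x, ENNReal.ofReal (bracket x ^ r) < ⊤ := by
  have := finite_integral_one_add_norm (E := ℝ) (μ := volume) (r := -r) (by simp; linarith)
  simpa [bracket] using this

theorem memLp_two_bracket_inv : MemLp (fun x => (bracket x)⁻¹) 2 volume := by
  have hm : AEStronglyMeasurable (fun x => (bracket x)⁻¹) volume :=
    (measurable_bracket.inv).aestronglyMeasurable
  rw [memLp_two_iff_integrable_sq hm]
  refine (integrable_bracket_rpow (r := -2) (by norm_num)).congr (ae_of_all _ fun x => ?_)
  simp only
  rw [Real.rpow_neg (bracket_pos x).le, inv_pow]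
  norm_cast

/-! ### A regularized Hilbert kernel -/

/-- The kernel `σ / (2πi (σ² + 1))`, a regularization of `1 / (2πi σ)`. -/
def hilbertKernel (σ : ℝ) : ℂ := σ / (2 * Real.pi * Complex.I * (σ ^ 2 + 1))

/-- The inverse Fourier transform of this function is `hilbertKernel`. -/
def dampedSign (s : ℝ) : ℂ :=
  if 0 < s then -(1 / 2) * Complex.exp (-2 * Real.pi * s)
  else 1 / 2 * Complex.exp (2 * Real.pi * s)

theorem norm_dampedSign_le (s : ℝ) : ‖dampedSign s‖ ≤ 1 := by
  have hpi := Real.pi_pos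
  unfold dampedSign
  split_ifs with h
  · have : ‖Complex.exp (-2 * Real.pi * s)‖ ≤ 1 := by
      rw [Complex.norm_exp]
      simp
      positivity
    rw [norm_mul, norm_neg]
    refine mul_le_one₀ (by norm_num) (norm_nonneg _) this
  · have : ‖Complex.exp (2 * Real.pi * s)‖ ≤ 1 := by
      rw [Complex.norm_exp]
      simp
      nlinarith
    rw [norm_mul]
    refine mul_le_one₀ (by norm_num) (norm_nonneg _) this

theorem measurable_dampedSign : Measurable dampedSign := by
  unfold dampedSign
  refine Measurable.ite measurableSet_Ioi ?_ ?_ <;> fun_prop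

theorem integrableOn_exp_mul_dampedSign_Ioi (σ : ℝ) :
    IntegrableOn (fun s : ℝ => Complex.exp (2 * Real.pi * Complex.I * σ * s) * dampedSign s)
        (Set.Ioi 0) ∧
      ∫ s in Set.Ioi (0 : ℝ), Complex.exp (2 * Real.pi * Complex.I * σ * s) * dampedSign s =
        1 / 2 / (-2 * Real.pi + 2 * Real.pi * Complex.I * σ) := by
  have hre : (-2 * Real.pi + 2 * Real.pi * Complex.I * σ : ℂ).re < 0 := by
    simp [Real.pi_pos]
  have e : ∀ s ∈ Set.Ioi (0 : ℝ),
      -(1 / 2) * Complex.exp ((-2 * Real.pi + 2 * Real.pi * Complex.I * σ) * s) =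
      Complex.exp (2 * Real.pi * Complex.I * σ * s) * dampedSign s := by
    intro s hs
    rw [dampedSign, if_pos (Set.mem_Ioi.mp hs), add_mul, Complex.exp_add]
    ring
  refine ⟨?_, ?_⟩
  · refine IntegrableOn.congr_fun ?_ e measurableSet_Ioi
    exact (integrableOn_exp_mul_complex_Ioi hre 0).const_mul _
  · rw [← setIntegral_congr_fun measurableSet_Ioi e, integral_const_mul,
      integral_exp_mul_complex_Ioi hre]
    simp
    ring

theorem integrableOn_exp_mul_dampedSign_Iic (σ : ℝ) :
    IntegrableOn (fun s : ℝ => Complex.exp (2 * Real.pi * Complex.I * σ * s) * dampedSign s)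
        (Set.Iic 0) ∧
      ∫ s in Set.Iic (0 : ℝ), Complex.exp (2 * Real.pi * Complex.I * σ * s) * dampedSign s =
        1 / 2 / (2 * Real.pi + 2 * Real.pi * Complex.I * σ) := by
  have hre : 0 < (2 * Real.pi + 2 * Real.pi * Complex.I * σ : ℂ).re := by
    simp [Real.pi_pos]
  have e : ∀ s ∈ Set.Iic (0 : ℝ),
      (1 / 2) * Complex.exp ((2 * Real.pi + 2 * Real.pi * Complex.I * σ) * s) =
      Complex.exp (2 * Real.pi * Complex.I * σ * s) * dampedSign s := by
    intro s hs
    rw [dampedSign, if_neg (not_lt.mpr hs), add_mul, Complex.exp_add]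
    ring
  refine ⟨?_, ?_⟩
  · refine IntegrableOn.congr_fun ?_ e measurableSet_Iic
    exact (integrableOn_exp_mul_complex_Iic hre 0).const_mul _
  · rw [← setIntegral_congr_fun measurableSet_Iic e, integral_const_mul,
      integral_exp_mul_complex_Iic hre]
    simp
    ring

theorem integrable_dampedSign : Integrable dampedSign := by
  rw [← integrableOn_univ, ← Set.Iic_union_Ioi (a := (0 : ℝ))]
  simpa using (integrableOn_exp_mul_dampedSign_Iic 0).1.union
    (integrableOn_exp_mul_dampedSign_Ioi 0).1

/-- Partial fractions: the two half-lines contribute simple poles at `σ = i` and `σ = -i`, and the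
even parts cancel. -/
theorem integral_exp_mul_dampedSign (σ : ℝ) :
    ∫ s : ℝ, Complex.exp (2 * Real.pi * Complex.I * σ * s) * dampedSign s = hilbertKernel σ := by
  rw [← intervalIntegral.integral_Iic_add_Ioi (integrableOn_exp_mul_dampedSign_Iic σ).1
    (integrableOn_exp_mul_dampedSign_Ioi σ).1, (integrableOn_exp_mul_dampedSign_Iic σ).2,
    (integrableOn_exp_mul_dampedSign_Ioi σ).2, hilbertKernel]
  have hpi : (Real.pi : ℂ) ≠ 0 := by exact_mod_cast Real.pi_ne_zero
  have h1 : (1 + Complex.I * σ : ℂ) ≠ 0 := fun h => by simpa using congrArg Complex.re h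
  have h2 : (-1 + Complex.I * σ : ℂ) ≠ 0 := fun h => by simpa using congrArg Complex.re h
  have h3 : (σ ^ 2 + 1 : ℂ) = -((1 + Complex.I * σ) * (-1 + Complex.I * σ)) := by
    linear_combination (σ ^ 2 : ℂ) * Complex.I_sq
  have e1 : (2 * Real.pi + 2 * Real.pi * Complex.I * σ : ℂ) =
    2 * Real.pi * (1 + Complex.I * σ) := by ring
  have e2 : (-2 * Real.pi + 2 * Real.pi * Complex.I * σ : ℂ) =
    2 * Real.pi * (-1 + Complex.I * σ) := by ring
  rw [h3, e1, e2]
  have hI := Complex.I_ne_zero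
  field_simp
  linear_combination (2 * σ : ℂ) * Complex.I_sq

theorem continuous_hilbertKernel : Continuous hilbertKernel := by
  unfold hilbertKernel
  refine Continuous.div (by fun_prop) (by fun_prop) fun σ => ?_
  have hpi : (Real.pi : ℂ) ≠ 0 := by exact_mod_cast Real.pi_ne_zero
  have : ((σ : ℂ) ^ 2 + 1) ≠ 0 := by
    have h : (0 : ℝ) < σ ^ 2 + 1 := by positivity
    exact_mod_cast h.ne'
  simp [hpi, this, Complex.I_ne_zero]

theorem norm_hilbertKernel (σ : ℝ) :
    ‖hilbertKernel σ‖ = |σ| / (2 * Real.pi * (σ ^ 2 + 1)) := by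
  have h : ‖((σ : ℂ) ^ 2 + 1)‖ = σ ^ 2 + 1 := by
    have h' : (0 : ℝ) ≤ σ ^ 2 + 1 := by positivity
    have : ((σ : ℂ) ^ 2 + 1) = ((σ ^ 2 + 1 : ℝ) : ℂ) := by push_cast; ring
    rw [this, Complex.norm_real, Real.norm_of_nonneg h']
  simp [hilbertKernel, h, abs_of_pos Real.pi_pos]

theorem norm_hilbertKernel_le (σ : ℝ) : ‖hilbertKernel σ‖ ≤ (bracket σ)⁻¹ := by
  have hpi := Real.pi_gt_three
  rw [norm_hilbertKernel, inv_eq_one_div, div_le_div_iff₀ (by positivity) (bracket_pos σ), bracket]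
  nlinarith [sq_abs σ, sq_nonneg (|σ| - 1), abs_nonneg σ]

theorem norm_hilbertKernel_le_inv_abs {σ : ℝ} (hσ : σ ≠ 0) : ‖hilbertKernel σ‖ ≤ |σ|⁻¹ := by
  refine (norm_hilbertKernel_le σ).trans ?_
  have := abs_pos.mpr hσ
  gcongr
  simp [bracket]

/-- Convolution with the reflected `hilbertKernel`. -/
def hilbertOp (F : ℝ → ℂ) (ρ : ℝ) : ℂ := ∫ τ, hilbertKernel (τ - ρ) * F τ

theorem memLp_hilbertKernel_sub (ρ : ℝ) : MemLp (fun τ => hilbertKernel (τ - ρ)) 2 volume := by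
  have h : MemLp hilbertKernel 2 volume :=
    memLp_two_bracket_inv.mono' continuous_hilbertKernel.aestronglyMeasurable
      (ae_of_all _ norm_hilbertKernel_le)
  exact h.comp_measurePreserving (measurePreserving_sub_right volume ρ)

theorem continuous_neg_innerₗ : Continuous fun p : ℝ × ℝ => (-innerₗ ℝ) p.1 p.2 := by
  simp only [LinearMap.neg_apply, innerₗ_apply_apply]
  fun_prop

/-- The convolution theorem. It exhibits `hilbertOp` as a Fourier multiplier with bounded symbol
`dampedSign`. -/
theorem hilbertOp_eq_fourier {F : ℝ → ℂ} (hF : Integrable F) :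
    hilbertOp F = 𝓕 (fun s => dampedSign s * 𝓕⁻ F s) := by
  funext ρ
  -- Modulating `dampedSign` by this phase translates its inverse transform, which at `τ` becomes
  -- `hilbertKernel (τ - ρ)`.
  have hint : Integrable fun s : ℝ =>
      Complex.exp (((-2 * Real.pi * s * ρ : ℝ) : ℂ) * Complex.I) * dampedSign s := by
    refine integrable_dampedSign.bdd_mul (c := 1) (by fun_prop) (ae_of_all _ fun s => ?_)
    rw [Complex.norm_exp_ofReal_mul_I]
  have h := VectorFourier.integral_fourierIntegral_smul_eq_flip (μ := (volume : Measure ℝ))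
    (ν := (volume : Measure ℝ)) (L := -innerₗ ℝ) Real.continuous_fourierChar
    continuous_neg_innerₗ hint hF
  have hflip : (-innerₗ ℝ).flip = -innerₗ ℝ := by
    ext; simp
  rw [hflip] at h
  rw [Real.fourier_real_eq_integral_exp_smul]
  refine Eq.trans ?_ (h.trans ?_)
  · refine integral_congr_ae (ae_of_all _ fun τ => ?_)
    simp only [smul_eq_mul]
    congr 1
    rw [← integral_exp_mul_dampedSign]
    change _ = 𝓕⁻ (fun s : ℝ =>
      Complex.exp (((-2 * Real.pi * s * ρ : ℝ) : ℂ) * Complex.I) * dampedSign s) τ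
    rw [Real.fourierInv_eq']
    refine integral_congr_ae (ae_of_all _ fun s => ?_)
    simp only [smul_eq_mul, ← mul_assoc, ← Complex.exp_add]
    congr 2
    simp
    ring
  · refine integral_congr_ae (ae_of_all _ fun s => ?_)
    simp only [smul_eq_mul, mul_assoc]
    rfl

/-- The multiplier has modulus at most `1`, so two uses of Plancherel give constant `1`. -/
theorem lintegral_enorm_sq_hilbertOp_le_of_integrable {F : ℝ → ℂ} (hF : Integrable F)
    (hF2 : MemLp F 2 volume) :
    ∫⁻ ρ, ‖hilbertOp F ρ‖ₑ ^ 2 ≤ ∫⁻ τ, ‖F τ‖ₑ ^ 2 := by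
  have hc : Continuous (𝓕⁻ F) := VectorFourier.fourierIntegral_continuous
    Real.continuous_fourierChar continuous_neg_innerₗ hF
  have hfin : MemLp (𝓕⁻ F) 2 volume := by
    refine ⟨hc.aestronglyMeasurable, ?_⟩
    have h := lintegral_enorm_sq_fourierInv hF hF2
    rw [lintegral_enorm_sq_eq_eLpNorm, lintegral_enorm_sq_eq_eLpNorm] at h
    have h2 : eLpNorm (𝓕⁻ F) 2 volume ^ 2 < ⊤ := by
      rw [h]; exact ENNReal.pow_lt_top hF2.2
    exact (ENNReal.pow_lt_top_iff.mp h2).resolve_right (by norm_num)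
  have hle : ∀ s, ‖dampedSign s * 𝓕⁻ F s‖ ≤ ‖𝓕⁻ F s‖ := fun s => by
    rw [norm_mul]
    exact mul_le_of_le_one_left (norm_nonneg _) (norm_dampedSign_le s)
  have hm : AEStronglyMeasurable (fun s => dampedSign s * 𝓕⁻ F s) volume :=
    measurable_dampedSign.aestronglyMeasurable.mul hc.aestronglyMeasurable
  rw [hilbertOp_eq_fourier hF, lintegral_enorm_sq_fourier, ← lintegral_enorm_sq_fourierInv hF hF2]
  · refine lintegral_mono fun s => ?_
    gcongr
    exact enorm_le_iff_norm_le.mpr (hle s)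
  · exact integrable_dampedSign.mul_bdd (c := ∫ x, ‖F x‖) hc.aestronglyMeasurable
      (ae_of_all _ fun x => VectorFourier.norm_fourierIntegral_le_integral_norm _ _ _ _ _)
  · exact hfin.mono hm (ae_of_all _ hle)

/-- The regularized Hilbert transform is bounded on `L²(ℝ)`. -/
theorem lintegral_enorm_sq_hilbertOp_le {F : ℝ → ℂ} (hF : MemLp F 2 volume) :
    ∫⁻ ρ, ‖hilbertOp F ρ‖ₑ ^ 2 ≤ ∫⁻ τ, ‖F τ‖ₑ ^ 2 := by
  -- Truncation to bounded intervals makes `F` integrable. The truncated transforms converge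
  -- pointwise, because the kernel is in `L²`, and Fatou's lemma passes the bound to the limit.
  let S : ℕ → Set ℝ := fun n => Set.Icc (-n : ℝ) n
  let Fn : ℕ → ℝ → ℂ := fun n => (S n).indicator F
  have hFn2 : ∀ n, MemLp (Fn n) 2 volume := fun n => hF.indicator measurableSet_Icc
  have hFn1 : ∀ n, Integrable (Fn n) := fun n => by
    rw [integrable_indicator_iff measurableSet_Icc]
    exact (hF.locallyIntegrable (by norm_num)).integrableOn_isCompact isCompact_Icc
  have hcont : ∀ n, Continuous (hilbertOp (Fn n)) := fun n => by
    rw [hilbertOp_eq_fourier (hFn1 n)]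
    have hc : Continuous (𝓕⁻ (Fn n)) := VectorFourier.fourierIntegral_continuous
      Real.continuous_fourierChar continuous_neg_innerₗ (hFn1 n)
    refine VectorFourier.fourierIntegral_continuous Real.continuous_fourierChar continuous_inner ?_
    exact integrable_dampedSign.mul_bdd (c := ∫ x, ‖Fn n x‖) hc.aestronglyMeasurable
      (ae_of_all _ fun x => VectorFourier.norm_fourierIntegral_le_integral_norm _ _ _ _ _)
  have hle : ∀ n τ, ‖Fn n τ‖ ≤ ‖F τ‖ := fun n τ => norm_indicator_le_norm_self _ _
  have hlim : ∀ ρ, Filter.Tendsto (fun n => hilbertOp (Fn n) ρ) Filter.atTop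
      (nhds (hilbertOp F ρ)) := by
    intro ρ
    have hk := memLp_hilbertKernel_sub ρ
    refine tendsto_integral_of_dominated_convergence (fun τ => ‖hilbertKernel (τ - ρ) * F τ‖)
      (fun n => hk.1.mul (hFn2 n).1) (hk.integrable_mul hF).norm (fun n => ae_of_all _ fun τ => ?_)
      (ae_of_all _ fun τ => ?_)
    · rw [norm_mul, norm_mul]
      gcongr
      exact hle n τ
    · refine tendsto_const_nhds.congr' ?_
      obtain ⟨N, hN⟩ := exists_nat_ge |τ|
      filter_upwards [Filter.eventually_ge_atTop N] with n hn
      have : τ ∈ S n := by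
        have hn' : (N : ℝ) ≤ n := by exact_mod_cast hn
        exact abs_le.mp (hN.trans hn')
      simp [Fn, this]
  calc ∫⁻ ρ, ‖hilbertOp F ρ‖ₑ ^ 2
      = ∫⁻ ρ, Filter.liminf (fun n => ‖hilbertOp (Fn n) ρ‖ₑ ^ 2) Filter.atTop := by
        refine lintegral_congr fun ρ => ?_
        exact (((ENNReal.continuous_pow 2).comp continuous_enorm).continuousAt.tendsto.comp
          (hlim ρ)).liminf_eq.symm
    _ ≤ Filter.liminf (fun n => ∫⁻ ρ, ‖hilbertOp (Fn n) ρ‖ₑ ^ 2) Filter.atTop :=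
        lintegral_liminf_le fun n => by
          have := (hcont n).measurable
          fun_prop
    _ ≤ ∫⁻ τ, ‖F τ‖ₑ ^ 2 := by
        refine Filter.liminf_le_of_le (by isBoundedDefault) fun c hc => ?_
        obtain ⟨n, hn⟩ := hc.exists
        refine hn.trans ((lintegral_enorm_sq_hilbertOp_le_of_integrable (hFn1 n) (hFn2 n)).trans ?_)
        refine lintegral_mono fun τ => ?_
        gcongr
        exact enorm_le_iff_norm_le.mpr (hle n τ)

/-! ### Powers of the weight as extended nonnegative reals -/

/-- The weight `(1 + |x|) ^ r`. -/
def bracketPow (r x : ℝ) : ℝ≥0∞ := ENNReal.ofReal (bracket x ^ r)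

@[fun_prop]
theorem measurable_bracketPow (r : ℝ) : Measurable (bracketPow r) := by
  unfold bracketPow; fun_prop

theorem bracketPow_mul (r s x : ℝ) : bracketPow r x * bracketPow s x = bracketPow (r + s) x := by
  rw [bracketPow, bracketPow, ← ENNReal.ofReal_mul (by have := bracket_pos x; positivity),
    ← Real.rpow_add (bracket_pos x), bracketPow]

theorem bracketPow_zero (x : ℝ) : bracketPow 0 x = 1 := by simp [bracketPow]

theorem bracketPow_sq (r x : ℝ) : bracketPow r x ^ 2 = bracketPow (2 * r) x := by
  rw [sq, bracketPow_mul, two_mul]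

theorem bracketPow_mono {r s : ℝ} (h : r ≤ s) (x : ℝ) : bracketPow r x ≤ bracketPow s x :=
  ENNReal.ofReal_le_ofReal (Real.rpow_le_rpow_of_exponent_le (one_le_bracket x) h)

theorem bracketPow_ne_top (r x : ℝ) : bracketPow r x ≠ ⊤ := ENNReal.ofReal_ne_top

theorem bracketPow_ne_zero (r x : ℝ) : bracketPow r x ≠ 0 := by
  have := bracket_pos x
  simp only [bracketPow, ne_eq, ENNReal.ofReal_eq_zero, not_le]
  positivity

theorem bracketPow_sub_comm (r x y : ℝ) : bracketPow r (x - y) = bracketPow r (y - x) := by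
  rw [bracketPow, bracket_sub_comm, bracketPow]

/-- Peetre's inequality. -/
theorem bracketPow_le_mul {r : ℝ} (hr : 0 ≤ r) (x y : ℝ) :
    bracketPow r x ≤ bracketPow r (x - y) * bracketPow r y := by
  have h1 := bracket_pos (x - y)
  have h2 := bracket_pos y
  rw [bracketPow, bracketPow, bracketPow, ← ENNReal.ofReal_mul (by positivity),
    ← Real.mul_rpow h1.le h2.le]
  exact ENNReal.ofReal_le_ofReal
    (Real.rpow_le_rpow (bracket_pos x).le (bracket_le_mul_bracket_sub x y) hr)

theorem bracketPow_neg_mul_self (r x : ℝ) : bracketPow (-r) x * bracketPow r x = 1 := by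
  rw [bracketPow_mul]; simp [bracketPow_zero]

theorem bracketPow_neg_le_mul {r : ℝ} (hr : 0 ≤ r) (x y : ℝ) :
    bracketPow (-r) x ≤ bracketPow r (x - y) * bracketPow (-r) y := by
  have h := bracketPow_le_mul hr y x
  rw [bracketPow_sub_comm] at h
  calc bracketPow (-r) x = bracketPow (-r) x * (bracketPow r y * bracketPow (-r) y) := by
        rw [mul_comm (bracketPow r y), bracketPow_neg_mul_self, mul_one]
    _ ≤ bracketPow (-r) x * ((bracketPow r (x - y) * bracketPow r x) * bracketPow (-r) y) := by
        gcongr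
    _ = (bracketPow (-r) x * bracketPow r x) * (bracketPow r (x - y) * bracketPow (-r) y) := by
        ring
    _ = _ := by rw [bracketPow_neg_mul_self, one_mul]

theorem bracketPow_neg_sub_le_mul {r : ℝ} (hr : 0 ≤ r) (x y : ℝ) :
    bracketPow (-r) (x - y) ≤ bracketPow r y * bracketPow (-r) x := by
  have h := bracketPow_neg_le_mul hr (x - y) x
  rwa [show x - y - x = 0 - y by ring, bracketPow_sub_comm r 0 y, sub_zero] at h

theorem lintegral_bracketPow_sub_left {r : ℝ} (x : ℝ) :
    ∫⁻ y, bracketPow r (x - y) = ∫⁻ y, bracketPow r y :=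
  lintegral_sub_left_eq_self (bracketPow r) x

theorem lintegral_bracketPow_sub_right {r : ℝ} (y : ℝ) :
    ∫⁻ x, bracketPow r (x - y) = ∫⁻ x, bracketPow r x :=
  lintegral_sub_right_eq_self (bracketPow r) y

theorem lintegral_bracketPow_lt_top {r : ℝ} (hr : r < -1) : ∫⁻ x, bracketPow r x < ⊤ :=
  lintegral_bracket_rpow_lt_top hr

theorem lintegral_bracketPow_abs_le {r R : ℝ} (hr : -1 < r) (hR : 0 ≤ R) :
    ∫⁻ x in {x : ℝ | |x| ≤ R}, bracketPow r x ≤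
      ENNReal.ofReal (2 / (r + 1) * (1 + R) ^ (r + 1)) := by
  have hS : MeasurableSet {x : ℝ | |x| ≤ R} := measurableSet_le (by fun_prop) (by fun_prop)
  have hcont : Continuous fun x => bracket x ^ r :=
    continuous_bracket.rpow_const fun x => Or.inl (bracket_pos x).ne'
  have hS' : {x : ℝ | |x| ≤ R} = Set.Icc (-R) R := by ext; simp [abs_le]
  have hint : IntegrableOn (fun x => bracket x ^ r) {x : ℝ | |x| ≤ R} := by
    rw [hS']; exact hcont.integrableOn_Icc
  simp only [bracketPow]
  rw [← ofReal_integral_eq_lintegral_ofReal hint (ae_of_all _ fun x => by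
    have := bracket_pos x; positivity)]
  refine ENNReal.ofReal_le_ofReal ?_
  rw [← integral_indicator hS]
  have e : ∀ x, Set.indicator {x : ℝ | |x| ≤ R} (fun x => bracket x ^ r) x =
      (fun y : ℝ => Set.indicator (Set.Iic R) (fun y => (1 + y) ^ r) y) |x| := by
    intro x
    simp [Set.indicator, bracket]
  simp_rw [e]
  rw [integral_comp_abs (f := fun y : ℝ => Set.indicator (Set.Iic R) (fun y => (1 + y) ^ r) y),
    setIntegral_indicator measurableSet_Iic, Set.Ioi_inter_Iic,
    ← intervalIntegral.integral_of_le hR,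
    intervalIntegral.integral_comp_add_left (fun y => y ^ r) 1, integral_rpow (Or.inl hr)]
  have h1 : 0 < r + 1 := by linarith
  rw [mul_div_assoc', div_mul_eq_mul_div]
  gcongr
  simp

theorem lintegral_bracketPow_lt_abs_le {r R : ℝ} (hr : r < -1) (hR : 0 ≤ R) :
    ∫⁻ x in {x : ℝ | R < |x|}, bracketPow r x ≤
      ENNReal.ofReal (2 / (-r - 1) * (1 + R) ^ (r + 1)) := by
  have hS : MeasurableSet {x : ℝ | R < |x|} := measurableSet_lt (by fun_prop) (by fun_prop)
  have hint : IntegrableOn (fun x => bracket x ^ r) {x : ℝ | R < |x|} :=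
    (integrable_bracket_rpow hr).integrableOn
  simp only [bracketPow]
  rw [← ofReal_integral_eq_lintegral_ofReal hint (ae_of_all _ fun x => by
    have := bracket_pos x; positivity)]
  refine ENNReal.ofReal_le_ofReal ?_
  rw [← integral_indicator hS]
  have e : ∀ x, Set.indicator {x : ℝ | R < |x|} (fun x => bracket x ^ r) x =
      (fun y : ℝ => Set.indicator (Set.Ioi R) (fun y => (1 + y) ^ r) y) |x| := by
    intro x
    simp [Set.indicator, bracket]
  simp_rw [e]
  have hIoi : Set.Ioi (0 : ℝ) ∩ Set.Ioi R = Set.Ioi R := by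
    rw [Set.Ioi_inter_Ioi, sup_eq_right.mpr hR]
  rw [integral_comp_abs (f := fun y : ℝ => Set.indicator (Set.Ioi R) (fun y => (1 + y) ^ r) y),
    setIntegral_indicator measurableSet_Ioi, hIoi]
  have hshift : ∫ y in Set.Ioi R, (1 + y) ^ r = ∫ y in Set.Ioi (1 + R), y ^ r := by
    have := (measurePreserving_add_left volume (1 : ℝ)).setIntegral_preimage_emb
      (measurableEmbedding_addLeft 1) (fun y : ℝ => y ^ r) (Set.Ioi (1 + R))
    simpa using this
  rw [hshift, integral_Ioi_rpow_of_lt hr (by linarith)]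
  have h1 : -r - 1 ≠ 0 := by linarith
  have h2 : r + 1 ≠ 0 := by linarith
  apply le_of_eq
  rw [mul_div_assoc', div_mul_eq_mul_div, div_eq_div_iff h2 h1]
  ring

/-! ### The weighted bound for the regularized Hilbert transform -/

/-- The Hardy-type kernel that dominates the commutator of the Hilbert transform with a weight. -/
def hardyKernel (x y : ℝ) : ℝ≥0∞ :=
  if |y| ≤ |x| then bracketPow (-1) x else bracketPow (-(1 / 3)) x * bracketPow (-(2 / 3)) y

theorem measurable_hardyKernel : Measurable (Function.uncurry hardyKernel) := by
  unfold hardyKernel Function.uncurry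
  refine Measurable.ite (measurableSet_le (by fun_prop) (by fun_prop)) ?_ ?_ <;> fun_prop

theorem lintegral_eq_add_abs (f : ℝ → ℝ≥0∞) (R : ℝ) :
    ∫⁻ y, f y = (∫⁻ y in {y : ℝ | |y| ≤ R}, f y) + ∫⁻ y in {y : ℝ | R < |y|}, f y := by
  have hS : MeasurableSet {x : ℝ | |x| ≤ R} := measurableSet_le (by fun_prop) (by fun_prop)
  have hc : {x : ℝ | R < |x|} = {x : ℝ | |x| ≤ R}ᶜ := by ext; simp
  rw [hc, lintegral_add_compl f hS]

/-- The row condition of Schur's test. With the test function `⟨y⟩^{-a}` the row condition needs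
`1/3 < a < 1` and the column condition `0 < a < 2/3`; `a = 1/2` is the midpoint of the common range.
The constants `4` and `12` are `2/(1/2)` and `2/(1/6)`. -/
theorem lintegral_hardyKernel_mul_right_le (x : ℝ) :
    ∫⁻ y, hardyKernel x y * bracketPow (-(1 / 2)) y ≤ 16 * bracketPow (-(1 / 2)) x := by
  have hS : MeasurableSet {y : ℝ | |y| ≤ |x|} := measurableSet_le (by fun_prop) (by fun_prop)
  have hT : MeasurableSet {y : ℝ | |x| < |y|} := measurableSet_lt (by fun_prop) (by fun_prop)
  rw [lintegral_eq_add_abs _ |x|]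
  have h1 : ∫⁻ y in {y : ℝ | |y| ≤ |x|}, hardyKernel x y * bracketPow (-(1 / 2)) y ≤
      4 * bracketPow (-(1 / 2)) x := by
    calc _ = ∫⁻ y in {y : ℝ | |y| ≤ |x|}, bracketPow (-1) x * bracketPow (-(1 / 2)) y :=
          setLIntegral_congr_fun hS fun y hy => by simp [hardyKernel, Set.mem_ofPred_eq.mp hy]
      _ = bracketPow (-1) x * ∫⁻ y in {y : ℝ | |y| ≤ |x|}, bracketPow (-(1 / 2)) y :=
          lintegral_const_mul _ (by fun_prop)
      _ ≤ bracketPow (-1) x *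
          ENNReal.ofReal (2 / (-(1 / 2) + 1) * (1 + |x|) ^ (-(1 / 2) + 1 : ℝ)) := by
          gcongr; exact lintegral_bracketPow_abs_le (by norm_num) (abs_nonneg x)
      _ = 4 * (bracketPow (-1) x * bracketPow (1 / 2) x) := by
          rw [ENNReal.ofReal_mul (by norm_num), bracketPow, bracketPow, bracket]
          norm_num
          ring
      _ = _ := by rw [bracketPow_mul]; norm_num
  have h2 : ∫⁻ y in {y : ℝ | |x| < |y|}, hardyKernel x y * bracketPow (-(1 / 2)) y ≤
      12 * bracketPow (-(1 / 2)) x := by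
    calc _ = ∫⁻ y in {y : ℝ | |x| < |y|}, bracketPow (-(1 / 3)) x * bracketPow (-(7 / 6)) y :=
          setLIntegral_congr_fun hT fun y hy => by
            simp only [hardyKernel, not_le.mpr (Set.mem_ofPred_eq.mp hy), if_false]
            rw [mul_assoc, bracketPow_mul]; norm_num
      _ = bracketPow (-(1 / 3)) x * ∫⁻ y in {y : ℝ | |x| < |y|}, bracketPow (-(7 / 6)) y :=
          lintegral_const_mul _ (by fun_prop)
      _ ≤ bracketPow (-(1 / 3)) x *
          ENNReal.ofReal (2 / (-(-(7 / 6)) - 1) * (1 + |x|) ^ (-(7 / 6) + 1 : ℝ)) := by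
          gcongr; exact lintegral_bracketPow_lt_abs_le (by norm_num) (abs_nonneg x)
      _ = 12 * (bracketPow (-(1 / 3)) x * bracketPow (-(1 / 6)) x) := by
          rw [ENNReal.ofReal_mul (by norm_num), bracketPow, bracketPow, bracket]
          norm_num
          ring
      _ = _ := by rw [bracketPow_mul]; norm_num
  refine (add_le_add h1 h2).trans (le_of_eq ?_)
  rw [← add_mul]; norm_num

theorem lintegral_hardyKernel_mul_left_le (y : ℝ) :
    ∫⁻ x, hardyKernel x y * bracketPow (-(1 / 2)) x ≤ 16 * bracketPow (-(1 / 2)) y := by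
  have hS : MeasurableSet {x : ℝ | |x| ≤ |y|} := measurableSet_le (by fun_prop) (by fun_prop)
  have hT : MeasurableSet {x : ℝ | |y| < |x|} := measurableSet_lt (by fun_prop) (by fun_prop)
  rw [lintegral_eq_add_abs _ |y|]
  have h1 : ∫⁻ x in {x : ℝ | |x| ≤ |y|}, hardyKernel x y * bracketPow (-(1 / 2)) x ≤
      12 * bracketPow (-(1 / 2)) y := by
    calc _ ≤ ∫⁻ x in {x : ℝ | |x| ≤ |y|}, bracketPow (-(2 / 3)) y * bracketPow (-(5 / 6)) x := by
          refine setLIntegral_mono' hS fun x hx => ?_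
          rw [hardyKernel]
          split_ifs with h
          -- This branch meets the region only where `|x| = |y|`, and there the two formulas of
          -- `hardyKernel` agree.
          · have e : bracketPow (-1) x = bracketPow (-(2 / 3)) y * bracketPow (-(1 / 3)) x := by
              have : |x| = |y| := le_antisymm hx h
              have : bracketPow (-(2 / 3)) y = bracketPow (-(2 / 3)) x := by
                simp [bracketPow, bracket, this]
              rw [this, bracketPow_mul]; norm_num
            rw [e, mul_assoc, bracketPow_mul]; norm_num
          · rw [mul_right_comm, bracketPow_mul, mul_comm]; norm_num
      _ = bracketPow (-(2 / 3)) y * ∫⁻ x in {x : ℝ | |x| ≤ |y|}, bracketPow (-(5 / 6)) x :=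
          lintegral_const_mul _ (by fun_prop)
      _ ≤ bracketPow (-(2 / 3)) y *
          ENNReal.ofReal (2 / (-(5 / 6) + 1) * (1 + |y|) ^ (-(5 / 6) + 1 : ℝ)) := by
          gcongr; exact lintegral_bracketPow_abs_le (by norm_num) (abs_nonneg y)
      _ = 12 * (bracketPow (-(2 / 3)) y * bracketPow (1 / 6) y) := by
          rw [ENNReal.ofReal_mul (by norm_num), bracketPow, bracketPow, bracket]
          norm_num
          ring
      _ = _ := by rw [bracketPow_mul]; norm_num
  have h2 : ∫⁻ x in {x : ℝ | |y| < |x|}, hardyKernel x y * bracketPow (-(1 / 2)) x ≤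
      4 * bracketPow (-(1 / 2)) y := by
    calc _ = ∫⁻ x in {x : ℝ | |y| < |x|}, bracketPow (-(3 / 2)) x :=
          setLIntegral_congr_fun hT fun x hx => by
            simp only [hardyKernel, (Set.mem_ofPred_eq.mp hx).le, if_true]
            rw [bracketPow_mul]; norm_num
      _ ≤ ENNReal.ofReal (2 / (-(-(3 / 2)) - 1) * (1 + |y|) ^ (-(3 / 2) + 1 : ℝ)) :=
          lintegral_bracketPow_lt_abs_le (by norm_num) (abs_nonneg y)
      _ = _ := by
          rw [ENNReal.ofReal_mul (by norm_num), bracketPow, bracket]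
          norm_num
  refine (add_le_add h1 h2).trans (le_of_eq ?_)
  rw [← add_mul]; norm_num

theorem lintegral_sq_hardyKernel_le {f : ℝ → ℝ≥0∞} (hf : AEMeasurable f) :
    ∫⁻ x, (∫⁻ y, hardyKernel x y * f y) ^ 2 ≤ 16 * 16 * ∫⁻ y, f y ^ 2 :=
  lintegral_sq_lintegral_mul_le_of_schur measurable_hardyKernel (measurable_bracketPow _)
    (measurable_bracketPow _) (bracketPow_ne_zero _) (bracketPow_ne_top _)
    lintegral_hardyKernel_mul_right_le lintegral_hardyKernel_mul_left_le hf

/-- Multiplication by `(1 + |τ|) ^ (-1/3)`, which maps the Fourier transforms of `H^{-1/3}` to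
`L²`. -/
def damp (G : ℝ → ℂ) (τ : ℝ) : ℂ := ((bracket τ ^ (-(1 / 3) : ℝ) : ℝ) : ℂ) * G τ

theorem enorm_damp (G : ℝ → ℂ) (τ : ℝ) : ‖damp G τ‖ₑ = bracketPow (-(1 / 3)) τ * ‖G τ‖ₑ := by
  have := bracket_pos τ
  rw [damp, enorm_mul, bracketPow, ← ofReal_norm, Complex.norm_real,
    Real.norm_of_nonneg (by positivity)]

theorem enorm_eq_mul_enorm_damp (G : ℝ → ℂ) (τ : ℝ) :
    ‖G τ‖ₑ = bracketPow (1 / 3) τ * ‖damp G τ‖ₑ := by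
  rw [enorm_damp, ← mul_assoc, mul_comm (bracketPow (1 / 3) τ), bracketPow_neg_mul_self, one_mul]

theorem aestronglyMeasurable_of_damp {G : ℝ → ℂ} (h : AEStronglyMeasurable (damp G) volume) :
    AEStronglyMeasurable G volume := by
  have hm : Measurable fun τ : ℝ => (((bracket τ ^ (-(1 / 3) : ℝ))⁻¹ : ℝ) : ℂ) := by fun_prop
  refine (hm.aestronglyMeasurable.mul h).congr (ae_of_all _ fun τ => ?_)
  have := bracket_pos τ
  have h0 : ((bracket τ ^ (-(1 / 3) : ℝ) : ℝ) : ℂ) ≠ 0 := by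
    have : bracket τ ^ (-(1 / 3) : ℝ) ≠ 0 := by positivity
    exact_mod_cast this
  simp only [Pi.mul_apply, damp, Complex.ofReal_inv]
  rw [inv_mul_cancel_left₀ h0]

/-- The pairing of `(1 + |τ|)⁻¹` with the Fourier transform of an element of `H^{-1/3}`. -/
theorem sq_lintegral_bracketPow_neg_one_mul_le {G : ℝ → ℂ} (hG : MemLp (damp G) 2 volume) :
    (∫⁻ τ, bracketPow (-1) τ * ‖G τ‖ₑ) ^ 2 ≤
      (∫⁻ τ, bracketPow (-(4 / 3)) τ) * ∫⁻ τ, ‖damp G τ‖ₑ ^ 2 := by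
  -- One third of the decay is spent on `damp`; what is left, `⟨τ⟩^{-2/3}`, is still square
  -- integrable because `4/3 > 1`.
  have e : ∀ τ, bracketPow (-1) τ * ‖G τ‖ₑ = bracketPow (-(2 / 3)) τ * ‖damp G τ‖ₑ := fun τ => by
    rw [enorm_eq_mul_enorm_damp, ← mul_assoc, bracketPow_mul]; norm_num
  have e2 : ∀ τ, bracketPow (-(4 / 3)) τ = bracketPow (-(2 / 3)) τ ^ 2 := fun τ => by
    rw [bracketPow_sq]; norm_num
  simp only [e, e2]
  exact lintegral_mul_sq_le (by fun_prop) hG.1.enorm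

theorem lintegral_bracketPow_neg_one_mul_lt_top {G : ℝ → ℂ} (hG : MemLp (damp G) 2 volume) :
    ∫⁻ τ, bracketPow (-1) τ * ‖G τ‖ₑ < ⊤ := by
  have h : (∫⁻ τ, bracketPow (-1) τ * ‖G τ‖ₑ) ^ 2 < ⊤ := by
    refine (sq_lintegral_bracketPow_neg_one_mul_le hG).trans_lt
      (ENNReal.mul_lt_top (lintegral_bracketPow_lt_top (by norm_num)) ?_)
    rw [lintegral_enorm_sq_eq_eLpNorm]
    exact ENNReal.pow_lt_top hG.2
  exact (ENNReal.pow_lt_top_iff.mp h).resolve_right (by norm_num)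

theorem enorm_hilbertKernel_sub_le (ρ τ : ℝ) :
    ‖hilbertKernel (τ - ρ)‖ₑ ≤ bracketPow 1 ρ * bracketPow (-1) τ := by
  have h1 : ‖hilbertKernel (τ - ρ)‖ₑ ≤ bracketPow (-1) (τ - ρ) := by
    rw [← ofReal_norm, bracketPow, Real.rpow_neg_one]
    exact ENNReal.ofReal_le_ofReal (norm_hilbertKernel_le _)
  exact h1.trans (bracketPow_neg_sub_le_mul zero_le_one τ ρ)

theorem integrable_hilbertKernel_mul {G : ℝ → ℂ} (hG : MemLp (damp G) 2 volume) (ρ : ℝ) :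
    Integrable fun τ => hilbertKernel (τ - ρ) * G τ := by
  refine ⟨(memLp_hilbertKernel_sub ρ).1.mul (aestronglyMeasurable_of_damp hG.1), ?_⟩
  rw [hasFiniteIntegral_iff_enorm]
  calc ∫⁻ τ, ‖hilbertKernel (τ - ρ) * G τ‖ₑ
      ≤ ∫⁻ τ, bracketPow 1 ρ * (bracketPow (-1) τ * ‖G τ‖ₑ) := by
        refine lintegral_mono fun τ => ?_
        rw [enorm_mul, ← mul_assoc]
        gcongr
        exact enorm_hilbertKernel_sub_le ρ τ
    _ < ⊤ := by
        rw [lintegral_const_mul' _ _ (bracketPow_ne_top _ _)]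
        exact ENNReal.mul_lt_top (bracketPow_ne_top _ _).lt_top
          (lintegral_bracketPow_neg_one_mul_lt_top hG)

/-- A crude pointwise bound with growth in `ρ`. It serves the region `|ξ| < 1`, where `ρ` is bounded
and the Jacobian of `dispersion` degenerates. -/
theorem enorm_hilbertOp_sq_le {G : ℝ → ℂ} (hG : MemLp (damp G) 2 volume) (ρ : ℝ) :
    ‖hilbertOp G ρ‖ₑ ^ 2 ≤ bracketPow 2 ρ *
      ((∫⁻ τ, bracketPow (-(4 / 3)) τ) * ∫⁻ τ, ‖damp G τ‖ₑ ^ 2) := by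
  have h : ‖hilbertOp G ρ‖ₑ ≤ bracketPow 1 ρ * ∫⁻ τ, bracketPow (-1) τ * ‖G τ‖ₑ := by
    refine (enorm_integral_le_lintegral_enorm _).trans ?_
    rw [← lintegral_const_mul' _ _ (bracketPow_ne_top _ _)]
    refine lintegral_mono fun τ => ?_
    rw [enorm_mul, ← mul_assoc]
    gcongr
    exact enorm_hilbertKernel_sub_le ρ τ
  calc ‖hilbertOp G ρ‖ₑ ^ 2 ≤ (bracketPow 1 ρ * ∫⁻ τ, bracketPow (-1) τ * ‖G τ‖ₑ) ^ 2 :=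
        pow_le_pow_left' h 2
    _ = bracketPow 2 ρ * (∫⁻ τ, bracketPow (-1) τ * ‖G τ‖ₑ) ^ 2 := by
        rw [mul_pow, bracketPow_sq]; norm_num
    _ ≤ _ := by gcongr; exact sq_lintegral_bracketPow_neg_one_mul_le hG

/-- The left side contains the factorization of `x³ - y³`, whose modulus is `||ρ| - |τ|| ≤ |τ - ρ|`,
and the kernel is at most `|τ - ρ|⁻¹`. -/
theorem norm_hilbertKernel_mul_abs_cbrt_sub_le {ρ τ x y : ℝ} (hx : 0 < x) (hy : 0 < y)
    (hxρ : x ^ 3 = bracket ρ) (hyτ : y ^ 3 = bracket τ) :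
    ‖hilbertKernel (τ - ρ)‖ * |x - y| * (x ^ 2 + x * y + y ^ 2) ≤ 1 := by
  rcases eq_or_ne τ ρ with h | h
  · simp [h, hilbertKernel]
  · have hpos : 0 < |τ - ρ| := abs_pos.mpr (sub_ne_zero.mpr h)
    have h1 : |x - y| * (x ^ 2 + x * y + y ^ 2) ≤ |τ - ρ| := by
      have e : |x - y| * (x ^ 2 + x * y + y ^ 2) = |bracket ρ - bracket τ| := by
        rw [← abs_of_pos (show 0 < x ^ 2 + x * y + y ^ 2 by positivity), ← abs_mul, ← hxρ, ← hyτ]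
        congr 1
        ring
      rw [e, abs_sub_comm τ ρ]
      simp only [bracket, add_sub_add_left_eq_sub]
      exact abs_abs_sub_abs_le ρ τ
    calc ‖hilbertKernel (τ - ρ)‖ * |x - y| * (x ^ 2 + x * y + y ^ 2)
        = ‖hilbertKernel (τ - ρ)‖ * (|x - y| * (x ^ 2 + x * y + y ^ 2)) := by ring
      _ ≤ |τ - ρ|⁻¹ * |τ - ρ| := by
          gcongr
          exact norm_hilbertKernel_le_inv_abs (sub_ne_zero.mpr h)
      _ = 1 := inv_mul_cancel₀ hpos.ne'

/-- With `x`, `y` the cube roots of the brackets, the commutator factor is `-(x - y)/x`. In `|H| |x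
- y| (x² + xy + y²) ≤ 1`, keeping only `x²` gives the bound `x⁻³` and keeping only `y²` gives `x⁻¹
y⁻²`; `hardyKernel` is the smaller of the two. -/
theorem enorm_hilbertKernel_mul_commutator_le (ρ τ : ℝ) :
    ‖hilbertKernel (τ - ρ) * ((bracket ρ ^ (-(1 / 3) : ℝ) * bracket τ ^ (1 / 3 : ℝ) - 1 : ℝ) : ℂ)‖ₑ
      ≤ hardyKernel ρ τ := by
  have ha := bracket_pos ρ
  have hb := bracket_pos τ
  set x := bracket ρ ^ (1 / 3 : ℝ) with hx
  set y := bracket τ ^ (1 / 3 : ℝ) with hy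
  have hx0 : 0 < x := by positivity
  have hy0 : 0 < y := by positivity
  have hx3 : x ^ 3 = bracket ρ := by
    rw [hx, ← Real.rpow_natCast, ← Real.rpow_mul ha.le]; norm_num
  have hy3 : y ^ 3 = bracket τ := by
    rw [hy, ← Real.rpow_natCast, ← Real.rpow_mul hb.le]; norm_num
  have hxi : bracket ρ ^ (-(1 / 3) : ℝ) = x⁻¹ := by rw [Real.rpow_neg ha.le]
  have hy2 : bracket τ ^ (-(2 / 3) : ℝ) = (y ^ 2)⁻¹ := by
    rw [Real.rpow_neg hb.le, hy, ← Real.rpow_natCast, ← Real.rpow_mul hb.le]; norm_num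
  have hmain := norm_hilbertKernel_mul_abs_cbrt_sub_le hx0 hy0 hx3 hy3
  have hD : ‖hilbertKernel (τ - ρ) *
      ((bracket ρ ^ (-(1 / 3) : ℝ) * y - 1 : ℝ) : ℂ)‖ =
      ‖hilbertKernel (τ - ρ)‖ * |x - y| * x⁻¹ := by
    rw [norm_mul, Complex.norm_real, Real.norm_eq_abs, hxi, mul_assoc]
    congr 1
    rw [show x⁻¹ * y - 1 = -((x - y) * x⁻¹) by field_simp; ring, abs_neg, abs_mul,
      abs_of_pos (inv_pos.mpr hx0)]
  set D := ‖hilbertKernel (τ - ρ)‖ * |x - y| with hDdef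
  have hD0 : 0 ≤ D := by positivity
  rw [← ofReal_norm, hD, hardyKernel]
  split_ifs with h
  · refine ENNReal.ofReal_le_ofReal ?_
    rw [Real.rpow_neg_one, ← hx3, ← one_div, ← one_div, mul_one_div,
      div_le_div_iff₀ hx0 (by positivity)]
    nlinarith [mul_nonneg hD0 (mul_pos hx0 hy0).le, mul_nonneg hD0 (sq_nonneg y), mul_pos hx0 hy0]
  · rw [bracketPow, bracketPow, ← ENNReal.ofReal_mul (by positivity), hxi, hy2]
    refine ENNReal.ofReal_le_ofReal ?_
    rw [mul_comm D]
    gcongr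
    rw [← one_div, le_div_iff₀ (by positivity)]
    nlinarith [mul_nonneg hD0 (mul_pos hx0 hy0).le, mul_nonneg hD0 (sq_nonneg x)]

/-- Commuting the weight past the operator leaves the unweighted operator on `damp G`, plus an
absolutely convergent integral with a Hardy-type kernel. -/
theorem bracketPow_mul_enorm_hilbertOp_le {G : ℝ → ℂ} (hG : MemLp (damp G) 2 volume) (ρ : ℝ) :
    bracketPow (-(1 / 3)) ρ * ‖hilbertOp G ρ‖ₑ ≤
      ‖hilbertOp (damp G) ρ‖ₑ + ∫⁻ τ, hardyKernel ρ τ * ‖damp G τ‖ₑ := by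
  have i1 := integrable_hilbertKernel_mul hG ρ
  have i2 : Integrable fun τ => hilbertKernel (τ - ρ) * damp G τ :=
    (memLp_hilbertKernel_sub ρ).integrable_mul hG
  set c : ℂ := ((bracket ρ ^ (-(1 / 3) : ℝ) : ℝ) : ℂ) with hc
  have e1 : bracketPow (-(1 / 3)) ρ * ‖hilbertOp G ρ‖ₑ = ‖c * hilbertOp G ρ‖ₑ :=
    (enorm_damp (hilbertOp G) ρ).symm
  have e2 : c * hilbertOp G ρ = hilbertOp (damp G) ρ +
      ∫ τ, (c * (hilbertKernel (τ - ρ) * G τ) - hilbertKernel (τ - ρ) * damp G τ) := by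
    rw [integral_sub (i1.const_mul c) i2, integral_const_mul, hilbertOp, hilbertOp]
    ring
  rw [e1, e2]
  refine (enorm_add_le _ _).trans ?_
  gcongr
  refine (enorm_integral_le_lintegral_enorm _).trans (lintegral_mono fun τ => ?_)
  have hb := bracket_pos τ
  have e3 : c * (hilbertKernel (τ - ρ) * G τ) - hilbertKernel (τ - ρ) * damp G τ =
      (hilbertKernel (τ - ρ) *
        ((bracket ρ ^ (-(1 / 3) : ℝ) * bracket τ ^ (1 / 3 : ℝ) - 1 : ℝ) : ℂ)) * damp G τ := by
    have h1 : ((bracket τ ^ (1 / 3 : ℝ) : ℝ) : ℂ) * ((bracket τ ^ (-(1 / 3) : ℝ) : ℝ) : ℂ) = 1 := by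
      rw [← Complex.ofReal_mul, ← Real.rpow_add hb]; norm_num
    rw [damp, hc]
    push_cast at h1 ⊢
    linear_combination (-(c * hilbertKernel (τ - ρ) * G τ)) * h1
  rw [e3, enorm_mul]
  gcongr
  exact enorm_hilbertKernel_mul_commutator_le ρ τ

theorem add_sq_le_two_mul (a b : ℝ≥0∞) : (a + b) ^ 2 ≤ 2 * (a ^ 2 + b ^ 2) := by
  have h := ENNReal.rpow_add_le_mul_rpow_add_rpow a b (p := 2) (by norm_num)
  norm_num at h
  exact h

/-- The regularized Hilbert transform is bounded on `L²` with the weight `(1 + |ρ|) ^ (-2/3)`. -/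
theorem lintegral_bracketPow_mul_enorm_hilbertOp_sq_le {G : ℝ → ℂ}
    (hG : MemLp (damp G) 2 volume) :
    ∫⁻ ρ, bracketPow (-(2 / 3)) ρ * ‖hilbertOp G ρ‖ₑ ^ 2 ≤ 514 * ∫⁻ τ, ‖damp G τ‖ₑ ^ 2 := by
  -- Only a.e. measurability of `damp G` is given, so measurability in `ρ` is obtained from a
  -- measurable representative.
  have hmK : Measurable fun ρ => ∫⁻ τ, hardyKernel ρ τ * ‖hG.1.mk _ τ‖ₑ := by
    have := hG.1.stronglyMeasurable_mk.measurable
    have := measurable_hardyKernel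
    refine Measurable.lintegral_prod_right' (f := fun p : ℝ × ℝ =>
      hardyKernel p.1 p.2 * ‖hG.1.mk _ p.2‖ₑ) ?_
    exact measurable_hardyKernel.mul (by fun_prop)
  have hK : ∀ ρ, ∫⁻ τ, hardyKernel ρ τ * ‖damp G τ‖ₑ =
      ∫⁻ τ, hardyKernel ρ τ * ‖hG.1.mk _ τ‖ₑ := fun ρ =>
    lintegral_congr_ae (by filter_upwards [hG.1.ae_eq_mk] with τ hτ; rw [hτ])
  calc ∫⁻ ρ, bracketPow (-(2 / 3)) ρ * ‖hilbertOp G ρ‖ₑ ^ 2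
      = ∫⁻ ρ, (bracketPow (-(1 / 3)) ρ * ‖hilbertOp G ρ‖ₑ) ^ 2 := by
        refine lintegral_congr fun ρ => ?_
        rw [mul_pow, bracketPow_sq]; norm_num
    _ ≤ ∫⁻ ρ, 2 * (‖hilbertOp (damp G) ρ‖ₑ ^ 2 + (∫⁻ τ, hardyKernel ρ τ * ‖damp G τ‖ₑ) ^ 2) :=
        lintegral_mono fun ρ => (pow_le_pow_left' (bracketPow_mul_enorm_hilbertOp_le hG ρ) 2).trans
          (add_sq_le_two_mul _ _)
    _ = 2 * ((∫⁻ ρ, ‖hilbertOp (damp G) ρ‖ₑ ^ 2) +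
          ∫⁻ ρ, (∫⁻ τ, hardyKernel ρ τ * ‖damp G τ‖ₑ) ^ 2) := by
        rw [lintegral_const_mul' _ _ (by norm_num), lintegral_add_right]
        simp only [hK]
        fun_prop
    _ ≤ 2 * ((∫⁻ τ, ‖damp G τ‖ₑ ^ 2) + 16 * 16 * ∫⁻ τ, ‖damp G τ‖ₑ ^ 2) := by
        exact mul_le_mul_right (add_le_add (lintegral_enorm_sq_hilbertOp_le hG)
          (lintegral_sq_hardyKernel_le hG.1.enorm)) 2
    _ = 514 * ∫⁻ τ, ‖damp G τ‖ₑ ^ 2 := by ring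

/-! ### The dispersion relation -/

/-- The dispersion relation `λ = ξ³` in the frequency variables of Mathlib's Fourier transform. -/
def dispersion (ξ : ℝ) : ℝ := (2 * Real.pi) ^ 2 * ξ ^ 3

@[fun_prop]
theorem continuous_dispersion : Continuous dispersion := by unfold dispersion; fun_prop

@[fun_prop]
theorem measurable_dispersion : Measurable dispersion := continuous_dispersion.measurable

/-- The constant is `1 + 64`, from `π ≤ 4`. -/
theorem bracket_dispersion_le {ξ : ℝ} (hξ : |ξ| < 1) : bracket (dispersion ξ) ≤ 65 := by
  have hpi := Real.pi_le_four
  have h0 := Real.pi_pos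
  have h3 : |ξ| ^ 3 ≤ 1 := pow_le_one₀ (abs_nonneg _) hξ.le
  rw [bracket, dispersion, abs_mul, abs_pow, abs_pow, abs_of_pos (by positivity)]
  have : (2 * Real.pi) ^ 2 ≤ 64 := by nlinarith
  nlinarith [pow_nonneg (abs_nonneg ξ) 3]

theorem injective_dispersion : Function.Injective dispersion := by
  intro x y h
  have h0 : (2 * Real.pi) ^ 2 ≠ 0 := by have := Real.pi_pos; positivity
  exact (Odd.strictMono_pow (by decide : Odd 3)).injective (mul_left_cancel₀ h0 h)

/-- Change of variables `ρ = dispersion ξ`: away from the critical point `ξ = 0` the Jacobian, of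
size `ξ²`, dominates `⟨ρ⟩^{2/3}`. -/
theorem setLIntegral_comp_dispersion_le (f : ℝ → ℝ≥0∞) :
    ∫⁻ ξ in {ξ : ℝ | |ξ| < 1}ᶜ, f (dispersion ξ) ≤ ∫⁻ ρ, bracketPow (-(2 / 3)) ρ * f ρ := by
  have hS : MeasurableSet {ξ : ℝ | |ξ| < 1}ᶜ :=
    (measurableSet_lt (by fun_prop) (by fun_prop)).compl
  have hpi := Real.pi_gt_three
  have hder : ∀ ξ ∈ {ξ : ℝ | |ξ| < 1}ᶜ, HasDerivWithinAt dispersion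
      ((2 * Real.pi) ^ 2 * (3 * ξ ^ 2)) {ξ : ℝ | |ξ| < 1}ᶜ ξ := fun ξ _ => by
    have := ((hasDerivAt_pow 3 ξ).const_mul ((2 * Real.pi) ^ 2)).hasDerivWithinAt
      (s := {ξ : ℝ | |ξ| < 1}ᶜ)
    norm_num at this
    exact this
  calc ∫⁻ ξ in {ξ : ℝ | |ξ| < 1}ᶜ, f (dispersion ξ)
      ≤ ∫⁻ ξ in {ξ : ℝ | |ξ| < 1}ᶜ, ENNReal.ofReal |(2 * Real.pi) ^ 2 * (3 * ξ ^ 2)| *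
          (bracketPow (-(2 / 3)) (dispersion ξ) * f (dispersion ξ)) := by
        refine setLIntegral_mono' hS fun ξ hξ => ?_
        have hξ1 : 1 ≤ |ξ| := not_lt.mp hξ
        have ha := bracket_pos (dispersion ξ)
        rw [← mul_assoc]
        refine le_mul_of_one_le_left' ?_
        rw [bracketPow, ← ENNReal.ofReal_mul (abs_nonneg _), ENNReal.one_le_ofReal,
          abs_of_nonneg (by positivity), Real.rpow_neg ha.le, ← div_eq_mul_inv,
          one_le_div (by positivity)]
        -- The cube of the desired inequality. Since `|ξ| ≥ 1`, the bracket is at most twice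
        -- `|dispersion ξ|`, and the loss `4` is absorbed by `27 (2π)²`.
        have h1 : bracket (dispersion ξ) ^ 2 ≤ ((2 * Real.pi) ^ 2 * (3 * ξ ^ 2)) ^ 3 := by
          have hb : bracket (dispersion ξ) ≤ 2 * ((2 * Real.pi) ^ 2 * |ξ| ^ 3) := by
            rw [bracket, dispersion, abs_mul, abs_pow, abs_pow, abs_of_pos (by positivity)]
            have : 1 ≤ |ξ| ^ 3 := one_le_pow₀ hξ1
            nlinarith
          calc bracket (dispersion ξ) ^ 2 ≤ (2 * ((2 * Real.pi) ^ 2 * |ξ| ^ 3)) ^ 2 := by gcongr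
            _ = (2 * Real.pi) ^ 4 * 4 * ξ ^ 6 := by
                rw [mul_pow, mul_pow, ← pow_mul, ← pow_mul]
                have : |ξ| ^ (3 * 2) = ξ ^ 6 := by
                  rw [show 3 * 2 = 6 by norm_num]; exact Even.pow_abs (by decide) ξ
                rw [this]; ring
            _ ≤ (2 * Real.pi) ^ 4 * ((2 * Real.pi) ^ 2 * 27) * ξ ^ 6 := by
                have : (0 : ℝ) ≤ ξ ^ 6 := by positivity
                gcongr
                nlinarith
            _ = _ := by ring
        calc bracket (dispersion ξ) ^ (2 / 3 : ℝ)
            = (bracket (dispersion ξ) ^ 2) ^ (1 / 3 : ℝ) := by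
              rw [← Real.rpow_natCast, ← Real.rpow_mul ha.le]; norm_num
          _ ≤ (((2 * Real.pi) ^ 2 * (3 * ξ ^ 2)) ^ 3) ^ (1 / 3 : ℝ) := by gcongr
          _ = (2 * Real.pi) ^ 2 * (3 * ξ ^ 2) := by
              rw [← Real.rpow_natCast, ← Real.rpow_mul (by positivity)]; norm_num
    _ = ∫⁻ ρ in dispersion '' {ξ : ℝ | |ξ| < 1}ᶜ, bracketPow (-(2 / 3)) ρ * f ρ :=
        (lintegral_image_eq_lintegral_abs_deriv_mul hS hder injective_dispersion.injOn
          fun ρ => bracketPow (-(2 / 3)) ρ * f ρ).symm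
    _ ≤ ∫⁻ ρ, bracketPow (-(2 / 3)) ρ * f ρ := setLIntegral_le_lintegral _ _

theorem volume_abs_lt_one : volume {ξ : ℝ | |ξ| < 1} = 2 := by
  have : {ξ : ℝ | |ξ| < 1} = Set.Ioo (-1) 1 := by ext; simp [abs_lt]
  rw [this, Real.volume_Ioo]
  norm_num

theorem measurableSet_abs_lt_one : MeasurableSet {ξ : ℝ | |ξ| < 1} :=
  measurableSet_lt (by fun_prop) (by fun_prop)

/-- The trace of `hilbertOp G` on the cubic is in `L²(dξ)`: the weighted bound handles `|ξ| ≥ 1`,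
the crude pointwise bound the set `|ξ| < 1` of measure `2`. -/
theorem exists_lintegral_hilbertOp_dispersion_le :
    ∃ C : ℝ≥0∞, C ≠ ⊤ ∧ ∀ G : ℝ → ℂ, MemLp (damp G) 2 volume →
      ∫⁻ ξ, ‖hilbertOp G (dispersion ξ)‖ₑ ^ 2 ≤ C * ∫⁻ τ, ‖damp G τ‖ₑ ^ 2 := by
  set A := ∫⁻ τ, bracketPow (-(4 / 3)) τ with hA
  have hAt : A ≠ ⊤ := (lintegral_bracketPow_lt_top (by norm_num)).ne
  refine ⟨ENNReal.ofReal (65 ^ 2) * A * 2 + 514, by finiteness, fun G hG => ?_⟩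
  rw [← lintegral_add_compl _ measurableSet_abs_lt_one, add_mul]
  refine add_le_add ?_ ((setLIntegral_comp_dispersion_le fun ρ => ‖hilbertOp G ρ‖ₑ ^ 2).trans
    (lintegral_bracketPow_mul_enorm_hilbertOp_sq_le hG))
  calc ∫⁻ ξ in {ξ : ℝ | |ξ| < 1}, ‖hilbertOp G (dispersion ξ)‖ₑ ^ 2
      ≤ ∫⁻ ξ in {ξ : ℝ | |ξ| < 1}, ENNReal.ofReal (65 ^ 2) * (A * ∫⁻ τ, ‖damp G τ‖ₑ ^ 2) := by
        refine setLIntegral_mono' measurableSet_abs_lt_one fun ξ hξ => ?_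
        refine (enorm_hilbertOp_sq_le hG _).trans ?_
        gcongr
        refine ENNReal.ofReal_le_ofReal ?_
        have h := bracket_dispersion_le hξ
        have h0 := bracket_pos (dispersion ξ)
        rw [Real.rpow_two]
        gcongr
    _ = _ := by
        rw [setLIntegral_const, volume_abs_lt_one]
        ring

/-- In the variable `ρ` this integrates an integrable bump centred at `l` against the density
`⟨ρ⟩^{-2/3}`, which is essentially constant on the scale of the bump. -/
theorem exists_lintegral_bracketPow_sub_dispersion_le {p : ℝ} (hp : 1 < p) :
    ∃ C : ℝ≥0∞, C ≠ ⊤ ∧ ∀ l : ℝ,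
      ∫⁻ ξ, bracketPow (-p) (l - dispersion ξ) ≤ C * bracketPow (-(2 / 3)) l := by
  set A := ∫⁻ x, bracketPow (-p) x with hA
  have hAt : A ≠ ⊤ := (lintegral_bracketPow_lt_top (by linarith)).ne
  set B := ENNReal.ofReal (65 ^ (2 / 3 : ℝ)) with hB
  have hsmall : ∀ l ξ : ℝ, |ξ| < 1 →
      bracketPow (-p) (l - dispersion ξ) ≤ B * bracketPow (-(2 / 3)) l := by
    intro l ξ hξ
    refine (bracketPow_mono (s := -(2 / 3)) (by linarith) _).trans ?_
    refine (bracketPow_neg_sub_le_mul (by norm_num) l (dispersion ξ)).trans ?_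
    gcongr
    refine ENNReal.ofReal_le_ofReal ?_
    have := (bracket_pos (dispersion ξ)).le
    gcongr
    exact bracket_dispersion_le hξ
  -- With `a = ⟨l-ρ⟩` and `b = ⟨ρ⟩`, subadditivity bounds `⟨l⟩^{2/3}` by `a^{2/3} + b^{2/3}`. The
  -- second term gives `a^{-p}`; the first gives `b^{-2/3} a^{2/3-p}`, where both exponents are
  -- negative, so the smaller of `a` and `b` can carry the whole power `-p`.
  have hpt : ∀ l ρ : ℝ, bracketPow (2 / 3) l * (bracketPow (-(2 / 3)) ρ * bracketPow (-p) (l - ρ)) ≤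
      2 * (bracketPow (-p) (l - ρ) + bracketPow (-p) ρ) := by
    intro l ρ
    have ha := bracket_pos (l - ρ)
    have hb := bracket_pos ρ
    have hl := bracket_pos l
    set a := bracket (l - ρ) with hadef
    set b := bracket ρ with hbdef
    have hlab : bracket l ≤ a + b := by
      rw [hadef, hbdef, bracket, bracket, bracket]
      have := abs_add_le (l - ρ) ρ
      rw [sub_add_cancel] at this
      linarith
    rw [bracketPow, bracketPow, bracketPow, bracketPow, ← ENNReal.ofReal_mul (by positivity),
      ← ENNReal.ofReal_mul (by positivity), ← ENNReal.ofReal_add (by positivity) (by positivity),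
      show (2 : ℝ≥0∞) = ENNReal.ofReal 2 by simp, ← ENNReal.ofReal_mul (by norm_num)]
    refine ENNReal.ofReal_le_ofReal ?_
    have hsub : bracket l ^ (2 / 3 : ℝ) ≤ a ^ (2 / 3 : ℝ) + b ^ (2 / 3 : ℝ) :=
      (Real.rpow_le_rpow hl.le hlab (by norm_num)).trans
        (Real.rpow_add_le_add_rpow ha.le hb.le (by norm_num) (by norm_num))
    have e1 : b ^ (2 / 3 : ℝ) * b ^ (-(2 / 3) : ℝ) = 1 := by rw [← Real.rpow_add hb]; norm_num
    have e2 : a ^ (2 / 3 : ℝ) * a ^ (-p) = a ^ (2 / 3 - p) := by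
      rw [← Real.rpow_add ha]; ring_nf
    have h3 : b ^ (-(2 / 3) : ℝ) * a ^ (2 / 3 - p) ≤ a ^ (-p) + b ^ (-p) := by
      rcases le_total a b with h | h
      · have : b ^ (-(2 / 3) : ℝ) ≤ a ^ (-(2 / 3) : ℝ) :=
          Real.rpow_le_rpow_of_nonpos ha h (by norm_num)
        calc b ^ (-(2 / 3) : ℝ) * a ^ (2 / 3 - p)
            ≤ a ^ (-(2 / 3) : ℝ) * a ^ (2 / 3 - p) := by gcongr
          _ = a ^ (-p) := by rw [← Real.rpow_add ha]; ring_nf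
          _ ≤ _ := le_add_of_nonneg_right (by positivity)
      · have : a ^ (2 / 3 - p) ≤ b ^ (2 / 3 - p) :=
          Real.rpow_le_rpow_of_nonpos hb h (by linarith)
        calc b ^ (-(2 / 3) : ℝ) * a ^ (2 / 3 - p)
            ≤ b ^ (-(2 / 3) : ℝ) * b ^ (2 / 3 - p) := by gcongr
          _ = b ^ (-p) := by rw [← Real.rpow_add hb]; ring_nf
          _ ≤ _ := le_add_of_nonneg_left (by positivity)
    have hap : 0 < a ^ (-p) := by positivity
    have hbp : 0 < b ^ (-p) := by positivity
    calc bracket l ^ (2 / 3 : ℝ) * (b ^ (-(2 / 3) : ℝ) * a ^ (-p))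
        ≤ (a ^ (2 / 3 : ℝ) + b ^ (2 / 3 : ℝ)) * (b ^ (-(2 / 3) : ℝ) * a ^ (-p)) := by gcongr
      _ = b ^ (-(2 / 3) : ℝ) * (a ^ (2 / 3 : ℝ) * a ^ (-p)) +
          (b ^ (2 / 3 : ℝ) * b ^ (-(2 / 3) : ℝ)) * a ^ (-p) := by ring
      _ ≤ 2 * (a ^ (-p) + b ^ (-p)) := by rw [e1, e2]; linarith
  have hlarge : ∀ l : ℝ, ∫⁻ ξ in {ξ : ℝ | |ξ| < 1}ᶜ, bracketPow (-p) (l - dispersion ξ) ≤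
      4 * A * bracketPow (-(2 / 3)) l := by
    intro l
    refine (setLIntegral_comp_dispersion_le fun ρ => bracketPow (-p) (l - ρ)).trans ?_
    calc ∫⁻ ρ, bracketPow (-(2 / 3)) ρ * bracketPow (-p) (l - ρ)
        ≤ ∫⁻ ρ, bracketPow (-(2 / 3)) l * (2 * (bracketPow (-p) (l - ρ) + bracketPow (-p) ρ)) := by
          refine lintegral_mono fun ρ => ?_
          calc _ = bracketPow (-(2 / 3)) l * (bracketPow (2 / 3) l *
                (bracketPow (-(2 / 3)) ρ * bracketPow (-p) (l - ρ))) := by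
                rw [← mul_assoc (bracketPow (-(2 / 3)) l), bracketPow_neg_mul_self, one_mul]
            _ ≤ _ := mul_le_mul_right (hpt l ρ) _
      _ = bracketPow (-(2 / 3)) l * (2 * (A + A)) := by
          rw [lintegral_const_mul _ (by fun_prop), lintegral_const_mul _ (by fun_prop),
            lintegral_add_left (by fun_prop), lintegral_bracketPow_sub_left]
      _ = _ := by ring
  refine ⟨B * 2 + 4 * A, by finiteness, fun l => ?_⟩
  rw [← lintegral_add_compl _ measurableSet_abs_lt_one, add_mul]
  refine add_le_add ?_ (hlarge l)
  calc ∫⁻ ξ in {ξ : ℝ | |ξ| < 1}, bracketPow (-p) (l - dispersion ξ)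
      ≤ ∫⁻ ξ in {ξ : ℝ | |ξ| < 1}, B * bracketPow (-(2 / 3)) l :=
        setLIntegral_mono' measurableSet_abs_lt_one fun ξ hξ => hsmall l ξ hξ
    _ = _ := by
        rw [setLIntegral_const, volume_abs_lt_one]
        ring

/-! ### Convolution with an integrable weight -/

/-- The convolution of `|G|` with `(1 + |τ|)⁻³`. -/
def smear (G : ℝ → ℂ) (l : ℝ) : ℝ≥0∞ := ∫⁻ τ, bracketPow (-3) (l - τ) * ‖G τ‖ₑ

/-- Peetre's inequality moves `⟨l⟩^{-1/3}` inside the convolution at the cost of `⟨l-τ⟩^{1/3}`. The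
kernel remains integrable, and Schur's test with constant weights is Young's inequality. -/
theorem exists_lintegral_smear_sq_le :
    ∃ C : ℝ≥0∞, C ≠ ⊤ ∧ ∀ G : ℝ → ℂ, MemLp (damp G) 2 volume →
      ∫⁻ l, bracketPow (-(2 / 3)) l * smear G l ^ 2 ≤ C * ∫⁻ τ, ‖damp G τ‖ₑ ^ 2 := by
  set A := ∫⁻ x, bracketPow (-2) x with hA
  have hAt : A ≠ ⊤ := (lintegral_bracketPow_lt_top (by norm_num)).ne
  refine ⟨A * A, by finiteness, fun G hG => ?_⟩
  calc ∫⁻ l, bracketPow (-(2 / 3)) l * smear G l ^ 2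
      ≤ ∫⁻ l, (∫⁻ τ, bracketPow (-2) (l - τ) * ‖damp G τ‖ₑ) ^ 2 := by
        refine lintegral_mono fun l => ?_
        have e : bracketPow (-(2 / 3)) l = bracketPow (-(1 / 3)) l ^ 2 := by
          rw [bracketPow_sq]; norm_num
        rw [e, ← mul_pow, smear, ← lintegral_const_mul' _ _ (bracketPow_ne_top _ _)]
        refine pow_le_pow_left' (lintegral_mono fun τ => ?_) 2
        calc bracketPow (-(1 / 3)) l * (bracketPow (-3) (l - τ) * ‖G τ‖ₑ)
            ≤ (bracketPow (1 / 3) (l - τ) * bracketPow (-(1 / 3)) τ) *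
              (bracketPow (-3) (l - τ) * ‖G τ‖ₑ) := by
              gcongr
              exact bracketPow_neg_le_mul (by norm_num) l τ
          _ = (bracketPow (1 / 3) (l - τ) * bracketPow (-3) (l - τ)) * ‖damp G τ‖ₑ := by
              rw [enorm_damp]; ring
          _ ≤ _ := by
              rw [bracketPow_mul]
              gcongr
              exact bracketPow_mono (by norm_num) _
    _ ≤ A * A * ∫⁻ τ, ‖damp G τ‖ₑ ^ 2 :=
        lintegral_sq_lintegral_mul_le_of_schur (K := fun l τ => bracketPow (-2) (l - τ))
          (p := fun _ => 1) (q := fun _ => 1)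
          ((measurable_bracketPow _).comp (measurable_fst.sub measurable_snd))
          measurable_const measurable_const (by simp) (by simp)
          (fun l => by simp [lintegral_bracketPow_sub_left, hA])
          (fun τ => by simp [lintegral_bracketPow_sub_right, hA]) hG.1.enorm

/-! ### The space-time symbol of the forcing term -/

/-- The integral kernel that maps `𝓕 g` to the space-time Fourier transform of the forcing term,
where `Θ` is the Fourier transform of the time cutoff. -/
def forcingKernel (Θ : ℝ → ℂ) (ρ l τ : ℝ) : ℂ :=
  (Θ (l - τ) - Θ (l - ρ)) / (2 * Real.pi * Complex.I * (τ - ρ))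

theorem exists_norm_mul_bracket_pow_le (Θ : 𝓢(ℝ, ℂ)) :
    ∃ C : ℝ, 0 ≤ C ∧ ∀ x, bracket x ^ 4 * ‖Θ x‖ ≤ C ∧ bracket x ^ 4 * ‖deriv Θ x‖ ≤ C := by
  let M : ℝ := 2 ^ 4 * (Finset.Iic (4, 1)).sup (fun m => SchwartzMap.seminorm ℝ m.1 m.2) Θ
  refine ⟨M, by positivity, fun x => ⟨?_, ?_⟩⟩
  · have := SchwartzMap.one_add_le_sup_seminorm_apply (𝕜 := ℝ) (m := (4, 1)) (k := 4) (n := 0)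
      (by norm_num) (by norm_num) Θ x
    simpa [bracket, M] using this
  · have := SchwartzMap.one_add_le_sup_seminorm_apply (𝕜 := ℝ) (m := (4, 1)) (k := 4) (n := 1)
      (by norm_num) (by norm_num) Θ x
    rw [norm_iteratedFDeriv_eq_norm_iteratedDeriv, iteratedDeriv_one] at this
    simpa [bracket, M] using this

theorem bracket_le_two_mul_of_abs_sub_le_one {x y : ℝ} (h : |x - y| ≤ 1) :
    bracket x ≤ 2 * bracket y := by
  refine (bracket_le_mul_bracket_sub x y).trans ?_
  have := bracket_pos y
  gcongr
  rw [bracket]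
  linarith

/-- Mean value inequality on the unit ball about `x`, where brackets vary by a factor of at most
`2`; hence `16 = 2⁴`. -/
theorem exists_norm_sub_mul_bracket_pow_le (Θ : 𝓢(ℝ, ℂ)) :
    ∃ C : ℝ, 0 ≤ C ∧ ∀ x y, |x - y| ≤ 1 → bracket x ^ 4 * ‖Θ x - Θ y‖ ≤ C * |x - y| := by
  obtain ⟨C, hC0, hC⟩ := exists_norm_mul_bracket_pow_le Θ
  refine ⟨16 * C, by positivity, fun x y hxy => ?_⟩
  have hx := bracket_pos x
  have hbound : ∀ z ∈ Metric.closedBall x 1, ‖deriv Θ z‖ ≤ 16 * C / bracket x ^ 4 := by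
    intro z hz
    have hz' : |x - z| ≤ 1 := by
      rw [abs_sub_comm]; simpa [Real.dist_eq] using hz
    have h1 := bracket_le_two_mul_of_abs_sub_le_one hz'
    have h2 := (hC z).2
    rw [le_div_iff₀ (by positivity)]
    calc ‖deriv Θ z‖ * bracket x ^ 4 ≤ ‖deriv Θ z‖ * (2 * bracket z) ^ 4 := by gcongr
      _ = 16 * (bracket z ^ 4 * ‖deriv Θ z‖) := by ring
      _ ≤ 16 * C := by gcongr
  have hyb : y ∈ Metric.closedBall x 1 := by
    rw [Metric.mem_closedBall, Real.dist_eq, abs_sub_comm]; exact hxy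
  have h := Convex.norm_image_sub_le_of_norm_deriv_le (f := Θ)
    (fun z _ => Θ.differentiableAt) hbound (convex_closedBall x 1)
    hyb (Metric.mem_closedBall_self zero_le_one)
  rw [Real.norm_eq_abs] at h
  calc bracket x ^ 4 * ‖Θ x - Θ y‖ ≤ bracket x ^ 4 * (16 * C / bracket x ^ 4 * |x - y|) := by gcongr
    _ = 16 * C * |x - y| := by field_simp

theorem norm_two_pi_I_mul (σ : ℝ) : ‖(2 * Real.pi * Complex.I * σ : ℂ)‖ = 2 * Real.pi * |σ| := by
  simp [abs_of_pos Real.pi_pos]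

/-- For `|τ - ρ| ≤ 1` the brackets of `l - τ` and `l - ρ` are comparable, and the difference
quotient of `Θ` is bounded with fourth-order decay. For `|τ - ρ| ≥ 1` subtracting `hilbertKernel`
improves the coefficient of `Θ(l-ρ)` from order `σ⁻¹` to `σ⁻³`. Exchanging one bracket for the other
costs a factor `2|σ|`, so `σ⁻¹` pays for one exchange and `σ⁻³` for three; this fixes the exponents
`1` and `3`. -/
theorem exists_norm_forcingKernel_add_le (Θ : 𝓢(ℝ, ℂ)) :
    ∃ C : ℝ, 0 ≤ C ∧ ∀ ρ l τ, ‖forcingKernel Θ ρ l τ + Θ (l - ρ) * hilbertKernel (τ - ρ)‖ ≤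
      C * ((bracket (l - ρ))⁻¹ * (bracket (l - τ) ^ 3)⁻¹) := by
  obtain ⟨C₁, hC₁0, hC₁⟩ := exists_norm_mul_bracket_pow_le Θ
  obtain ⟨C₂, hC₂0, hC₂⟩ := exists_norm_sub_mul_bracket_pow_le Θ
  -- The near regime needs `8 C₁ + 2 C₂`, the far regime `2 C₁ + 8 C₁`.
  refine ⟨10 * C₁ + 2 * C₂, by positivity, fun ρ l τ => ?_⟩
  have hpi := Real.pi_gt_three
  set σ := τ - ρ with hσ
  set x := l - τ with hx
  set y := l - ρ with hy
  have hyx : y - x = σ := by rw [hx, hy, hσ]; ring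
  set X := bracket x with hX
  set Y := bracket y with hY
  have hX0 : 0 < X := bracket_pos x
  have hY0 : 0 < Y := bracket_pos y
  have hσc : ((τ : ℂ) - ρ) = (σ : ℝ) := by rw [hσ]; push_cast; ring
  rw [forcingKernel, ← hx, ← hy, hσc, ← mul_inv, ← div_eq_mul_inv, le_div_iff₀ (by positivity)]
  -- On the diagonal division by zero makes `forcingKernel` vanish, and `hilbertKernel 0 = 0`, so
  -- the left side is `0`.
  rcases eq_or_ne σ 0 with h0 | h0
  · simp only [h0, hilbertKernel, Complex.ofReal_zero, mul_zero, div_zero, zero_div, add_zero,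
      norm_zero, zero_mul]
    positivity
  have hσ0 : 0 < |σ| := abs_pos.mpr h0
  rcases le_total |σ| 1 with h1 | h1
  · have hYX : Y ≤ 2 * X := bracket_le_two_mul_of_abs_sub_le_one (by rw [hyx]; exact h1)
    have hXY : X ≤ 2 * Y :=
      bracket_le_two_mul_of_abs_sub_le_one (by rw [abs_sub_comm, hyx]; exact h1)
    have hd := hC₂ x y (by rw [abs_sub_comm, hyx]; exact h1)
    rw [abs_sub_comm, hyx] at hd
    have hk : ‖hilbertKernel σ‖ ≤ 1 :=
      (norm_hilbertKernel_le σ).trans (inv_le_one_of_one_le₀ (one_le_bracket σ))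
    have hA : ‖(Θ x - Θ y) / (2 * Real.pi * Complex.I * σ)‖ * (Y * X ^ 3) ≤ 2 * C₂ := by
      rw [norm_div, norm_two_pi_I_mul, div_mul_eq_mul_div, div_le_iff₀ (by positivity)]
      calc ‖Θ x - Θ y‖ * (Y * X ^ 3) ≤ ‖Θ x - Θ y‖ * ((2 * X) * X ^ 3) := by gcongr
        _ = 2 * (X ^ 4 * ‖Θ x - Θ y‖) := by ring
        _ ≤ 2 * (C₂ * |σ|) := by gcongr
        _ ≤ 2 * C₂ * (2 * Real.pi * |σ|) := by
            nlinarith [mul_nonneg hC₂0 hσ0.le]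
    have hB : ‖Θ y * hilbertKernel σ‖ * (Y * X ^ 3) ≤ 8 * C₁ := by
      rw [norm_mul]
      calc ‖Θ y‖ * ‖hilbertKernel σ‖ * (Y * X ^ 3) ≤ ‖Θ y‖ * 1 * (Y * (2 * Y) ^ 3) := by gcongr
        _ = 8 * (Y ^ 4 * ‖Θ y‖) := by ring
        _ ≤ 8 * C₁ := by gcongr; exact (hC₁ y).1
    calc _ ≤ (‖(Θ x - Θ y) / (2 * Real.pi * Complex.I * σ)‖ + ‖Θ y * hilbertKernel σ‖) *
          (Y * X ^ 3) := by gcongr; exact norm_add_le _ _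
      _ ≤ 2 * C₂ + 8 * C₁ := by rw [add_mul]; exact add_le_add hA hB
      _ ≤ _ := by linarith
  · set S := bracket σ with hS
    have hS2 : S ≤ 2 * |σ| := by rw [hS, bracket]; linarith
    have hS0 : 0 < S := bracket_pos σ
    have hYS : Y ≤ S * X := by
      have := bracket_le_mul_bracket_sub y x
      rwa [hyx] at this
    have hXS : X ≤ S * Y := by
      have := bracket_le_mul_bracket_sub x y
      rwa [bracket_sub_comm x y, hyx] at this
    have e : (Θ x - Θ y) / (2 * Real.pi * Complex.I * σ) + Θ y * hilbertKernel σ =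
        Θ x / (2 * Real.pi * Complex.I * σ) -
          Θ y / (2 * Real.pi * Complex.I * (σ * (σ ^ 2 + 1) : ℝ)) := by
      have hpi0 : (Real.pi : ℂ) ≠ 0 := by exact_mod_cast Real.pi_ne_zero
      have hs0 : (σ : ℂ) ≠ 0 := by exact_mod_cast h0
      have hs1 : ((σ : ℂ) ^ 2 + 1) ≠ 0 := by
        have h : (0 : ℝ) < σ ^ 2 + 1 := by positivity
        exact_mod_cast h.ne'
      have hI := Complex.I_ne_zero
      rw [hilbertKernel]
      push_cast
      field_simp
      ring
    have hA : ‖Θ x / (2 * Real.pi * Complex.I * σ)‖ * (Y * X ^ 3) ≤ 2 * C₁ := by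
      rw [norm_div, norm_two_pi_I_mul, div_mul_eq_mul_div, div_le_iff₀ (by positivity)]
      calc ‖Θ x‖ * (Y * X ^ 3) ≤ ‖Θ x‖ * ((2 * |σ| * X) * X ^ 3) := by
            gcongr; exact hYS.trans (by gcongr)
        _ = 2 * |σ| * (X ^ 4 * ‖Θ x‖) := by ring
        _ ≤ 2 * |σ| * C₁ := by gcongr; exact (hC₁ x).1
        _ ≤ 2 * C₁ * (2 * Real.pi * |σ|) := by nlinarith [mul_nonneg hC₁0 hσ0.le]
    have hB : ‖Θ y / (2 * Real.pi * Complex.I * (σ * (σ ^ 2 + 1) : ℝ))‖ * (Y * X ^ 3) ≤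
        8 * C₁ := by
      rw [norm_div, norm_two_pi_I_mul, div_mul_eq_mul_div, div_le_iff₀ (by positivity)]
      have h3 : |σ| ^ 3 ≤ |σ * (σ ^ 2 + 1)| := by
        rw [abs_mul, abs_of_pos (show 0 < σ ^ 2 + 1 by positivity)]
        nlinarith [sq_abs σ]
      calc ‖Θ y‖ * (Y * X ^ 3) ≤ ‖Θ y‖ * (Y * (2 * |σ| * Y) ^ 3) := by
            gcongr; exact hXS.trans (by gcongr)
        _ = 8 * |σ| ^ 3 * (Y ^ 4 * ‖Θ y‖) := by ring
        _ ≤ 8 * |σ * (σ ^ 2 + 1)| * C₁ := by gcongr; exact (hC₁ y).1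
        _ ≤ 8 * C₁ * (2 * Real.pi * |σ * (σ ^ 2 + 1)|) := by
            nlinarith [mul_nonneg hC₁0 (abs_nonneg (σ * (σ ^ 2 + 1)))]
    rw [e]
    calc _ ≤ (‖Θ x / (2 * Real.pi * Complex.I * σ)‖ +
          ‖Θ y / (2 * Real.pi * Complex.I * (σ * (σ ^ 2 + 1) : ℝ))‖) *
          (Y * X ^ 3) := by gcongr; exact norm_sub_le _ _
      _ ≤ 2 * C₁ + 8 * C₁ := by rw [add_mul]; exact add_le_add hA hB
      _ ≤ _ := by linarith

/-- The space-time Fourier transform of the forcing term, if `G` is that of the boundary datum. -/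
def forcingSymbol (Θ G : ℝ → ℂ) (ξ l : ℝ) : ℂ := ∫ τ, G τ * forcingKernel Θ (dispersion ξ) l τ

theorem measurable_forcingKernel {Θ : ℝ → ℂ} (hΘ : Measurable Θ) :
    Measurable fun p : ℝ × ℝ × ℝ => forcingKernel Θ p.1 p.2.1 p.2.2 := by
  unfold forcingKernel
  fun_prop

theorem measurable_forcingSymbol {Θ G : ℝ → ℂ} (hΘ : Measurable Θ) (hG : Measurable G) :
    Measurable fun p : ℝ × ℝ => forcingSymbol Θ G p.1 p.2 := by
  have hm : Measurable fun q : (ℝ × ℝ) × ℝ =>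
      G q.2 * forcingKernel Θ (dispersion q.1.1) q.1.2 q.2 :=
    (hG.comp measurable_snd).mul ((measurable_forcingKernel hΘ).comp
      (by fun_prop : Measurable fun q : (ℝ × ℝ) × ℝ => (dispersion q.1.1, q.1.2, q.2)))
  exact (hm.stronglyMeasurable.integral_prod_right' (ν := volume)).measurable

theorem measurable_smear {G : ℝ → ℂ} (hG : Measurable G) : Measurable (smear G) := by
  unfold smear
  exact Measurable.lintegral_prod_right' (f := fun p : ℝ × ℝ =>
    bracketPow (-3) (p.1 - p.2) * ‖G p.2‖ₑ) (by fun_prop)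

theorem smear_lt_top {G : ℝ → ℂ} (hG : MemLp (damp G) 2 volume) (l : ℝ) : smear G l < ⊤ := by
  calc smear G l ≤ ∫⁻ τ, bracketPow 1 l * (bracketPow (-1) τ * ‖G τ‖ₑ) := by
        refine lintegral_mono fun τ => ?_
        rw [← mul_assoc]
        gcongr
        rw [bracketPow_sub_comm]
        exact (bracketPow_mono (by norm_num) _).trans (bracketPow_neg_sub_le_mul zero_le_one τ l)
    _ < ⊤ := by
        rw [lintegral_const_mul' _ _ (bracketPow_ne_top _ _)]
        exact ENNReal.mul_lt_top (bracketPow_ne_top _ _).lt_top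
          (lintegral_bracketPow_neg_one_mul_lt_top hG)

theorem exists_enorm_forcingKernel_add_le (Θ : 𝓢(ℝ, ℂ)) :
    ∃ C : ℝ≥0∞, C ≠ ⊤ ∧ ∀ ρ l τ,
      ‖forcingKernel Θ ρ l τ + Θ (l - ρ) * hilbertKernel (τ - ρ)‖ₑ ≤
        C * bracketPow (-1) (l - ρ) * bracketPow (-3) (l - τ) := by
  obtain ⟨C, hC0, hC⟩ := exists_norm_forcingKernel_add_le Θ
  refine ⟨ENNReal.ofReal C, ENNReal.ofReal_ne_top, fun ρ l τ => ?_⟩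
  have h1 := bracket_pos (l - ρ)
  have h2 := bracket_pos (l - τ)
  rw [← ofReal_norm, bracketPow, bracketPow, ← ENNReal.ofReal_mul hC0,
    ← ENNReal.ofReal_mul (by positivity)]
  refine ENNReal.ofReal_le_ofReal ((hC ρ l τ).trans (le_of_eq ?_))
  rw [Real.rpow_neg_one, Real.rpow_neg h2.le, mul_assoc]
  norm_cast

/-- Free evolution plus remainder: the first term lives near the cubic `l = dispersion ξ`, the
second decays off it only like `⟨l - dispersion ξ⟩⁻¹`. -/
theorem exists_enorm_forcingSymbol_le (Θ : 𝓢(ℝ, ℂ)) :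
    ∃ C : ℝ≥0∞, C ≠ ⊤ ∧ ∀ G : ℝ → ℂ, MemLp (damp G) 2 volume → ∀ ξ l,
      ‖forcingSymbol Θ G ξ l‖ₑ ≤ ‖Θ (l - dispersion ξ)‖ₑ * ‖hilbertOp G (dispersion ξ)‖ₑ +
        C * (bracketPow (-1) (l - dispersion ξ) * smear G l) := by
  obtain ⟨C, hCt, hC⟩ := exists_enorm_forcingKernel_add_le Θ
  refine ⟨C, hCt, fun G hG ξ l => ?_⟩
  set ρ := dispersion ξ with hρ
  have hGm := aestronglyMeasurable_of_damp hG.1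
  have i1 := integrable_hilbertKernel_mul hG ρ
  have hle : ∫⁻ τ, ‖G τ * (forcingKernel Θ ρ l τ + Θ (l - ρ) * hilbertKernel (τ - ρ))‖ₑ ≤
      C * (bracketPow (-1) (l - ρ) * smear G l) := by
    rw [← mul_assoc, smear, ← lintegral_const_mul' _ _
      (ENNReal.mul_ne_top hCt (bracketPow_ne_top _ _))]
    refine lintegral_mono fun τ => ?_
    rw [enorm_mul, mul_comm, ← mul_assoc]
    gcongr
    exact hC ρ l τ
  have i2 : Integrable fun τ =>
      G τ * (forcingKernel Θ ρ l τ + Θ (l - ρ) * hilbertKernel (τ - ρ)) := by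
    refine ⟨hGm.mul (Measurable.aestronglyMeasurable ?_), ?_⟩
    · have h1 := continuous_hilbertKernel.measurable
      have h2 : Measurable fun τ => forcingKernel Θ ρ l τ :=
        (measurable_forcingKernel Θ.continuous.measurable).comp
          (by fun_prop : Measurable fun τ : ℝ => (ρ, l, τ))
      fun_prop
    · rw [hasFiniteIntegral_iff_enorm]
      refine hle.trans_lt ?_
      have := smear_lt_top hG l
      have := bracketPow_ne_top (-1) (l - ρ)
      finiteness
  have e : forcingSymbol Θ G ξ l =
      -(Θ (l - ρ) * hilbertOp G ρ) +
        ∫ τ, G τ * (forcingKernel Θ ρ l τ + Θ (l - ρ) * hilbertKernel (τ - ρ)) := by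
    rw [forcingSymbol, hilbertOp, ← integral_const_mul, neg_add_eq_sub,
      ← integral_sub i2 (i1.const_mul _)]
    refine integral_congr_ae (ae_of_all _ fun τ => ?_)
    simp only
    ring
  rw [e]
  refine (enorm_add_le _ _).trans ?_
  rw [enorm_neg, enorm_mul]
  gcongr
  exact (enorm_integral_le_lintegral_enorm _).trans hle

theorem exists_enorm_le_bracketPow (Θ : 𝓢(ℝ, ℂ)) :
    ∃ C : ℝ≥0∞, C ≠ ⊤ ∧ ∀ x, ‖Θ x‖ₑ ≤ C * bracketPow (-4) x := by
  obtain ⟨C, hC0, hC⟩ := exists_norm_mul_bracket_pow_le Θ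
  refine ⟨ENNReal.ofReal C, ENNReal.ofReal_ne_top, fun x => ?_⟩
  have h := bracket_pos x
  rw [← ofReal_norm, bracketPow, ← ENNReal.ofReal_mul hC0, Real.rpow_neg h.le]
  refine ENNReal.ofReal_le_ofReal ?_
  norm_cast
  rw [← div_eq_mul_inv, le_div_iff₀ (by positivity), mul_comm]
  exact (hC x).1

/-- The contribution of the free evolution to the weighted norms. -/
theorem exists_lintegral_free_part_le (Θ : 𝓢(ℝ, ℂ)) {r : ℝ} (hr : r < 7) :
    ∃ C : ℝ≥0∞, C ≠ ⊤ ∧ ∀ G : ℝ → ℂ, MemLp (damp G) 2 volume →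
      ∫⁻ ξ, ∫⁻ l, bracketPow r (l - dispersion ξ) *
        (‖Θ (l - dispersion ξ)‖ₑ * ‖hilbertOp G (dispersion ξ)‖ₑ) ^ 2 ≤
          C * ∫⁻ τ, ‖damp G τ‖ₑ ^ 2 := by
  obtain ⟨C₁, hC₁t, hC₁⟩ := exists_enorm_le_bracketPow Θ
  obtain ⟨C₂, hC₂t, hC₂⟩ := exists_lintegral_hilbertOp_dispersion_le
  -- `|Θ|²` decays to order `8`, and `r - 8 < -1` is the condition `r < 7`.
  set A := ∫⁻ x, bracketPow (r - 8) x with hA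
  have hAt : A ≠ ⊤ := (lintegral_bracketPow_lt_top (by linarith)).ne
  refine ⟨C₁ ^ 2 * A * C₂, by finiteness, fun G hG => ?_⟩
  calc _ ≤ ∫⁻ ξ, C₁ ^ 2 * A * ‖hilbertOp G (dispersion ξ)‖ₑ ^ 2 := by
        refine lintegral_mono fun ξ => ?_
        simp only
        calc _ ≤ ∫⁻ l, C₁ ^ 2 * ‖hilbertOp G (dispersion ξ)‖ₑ ^ 2 *
              bracketPow (r - 8) (l - dispersion ξ) := by
              refine lintegral_mono fun l => ?_
              calc _ ≤ bracketPow r (l - dispersion ξ) *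
                    ((C₁ * bracketPow (-4) (l - dispersion ξ)) *
                      ‖hilbertOp G (dispersion ξ)‖ₑ) ^ 2 := by
                    gcongr; exact hC₁ _
                _ = C₁ ^ 2 * ‖hilbertOp G (dispersion ξ)‖ₑ ^ 2 *
                    (bracketPow r (l - dispersion ξ) *
                      bracketPow (-4) (l - dispersion ξ) ^ 2) := by ring
                _ = _ := by rw [bracketPow_sq, bracketPow_mul]; ring_nf
          _ = C₁ ^ 2 * ‖hilbertOp G (dispersion ξ)‖ₑ ^ 2 * A := by
              rw [lintegral_const_mul _ (by fun_prop), lintegral_bracketPow_sub_right]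
          _ = _ := by ring
    _ = C₁ ^ 2 * A * ∫⁻ ξ, ‖hilbertOp G (dispersion ξ)‖ₑ ^ 2 :=
        lintegral_const_mul' _ _ (by finiteness)
    _ ≤ C₁ ^ 2 * A * (C₂ * ∫⁻ τ, ‖damp G τ‖ₑ ^ 2) := by gcongr; exact hC₂ G hG
    _ = _ := by ring

theorem enorm_sq_le_of_le_add {a u v w : ℝ≥0∞} (h : a ≤ u + v) :
    w * a ^ 2 ≤ 2 * (w * u ^ 2) + 2 * (w * v ^ 2) := by
  calc w * a ^ 2 ≤ w * (2 * (u ^ 2 + v ^ 2)) := by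
        gcongr; exact (pow_le_pow_left' h 2).trans (add_sq_le_two_mul u v)
    _ = _ := by ring

/-- The `X_b` bound for the symbol of the forcing term. -/
theorem exists_lintegral_forcingSymbol_le (Θ : 𝓢(ℝ, ℂ)) {b : ℝ} (hb : b < 1 / 2) :
    ∃ C : ℝ≥0∞, C ≠ ⊤ ∧ ∀ G : ℝ → ℂ, Measurable G → MemLp (damp G) 2 volume →
      ∫⁻ ξ, ∫⁻ l, bracketPow (2 * b) (l - dispersion ξ) * ‖forcingSymbol Θ G ξ l‖ₑ ^ 2 ≤
        C * ∫⁻ τ, ‖damp G τ‖ₑ ^ 2 := by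
  obtain ⟨C₁, hC₁t, hC₁⟩ := exists_enorm_forcingSymbol_le Θ
  obtain ⟨C₂, hC₂t, hC₂⟩ := exists_lintegral_free_part_le Θ (r := 2 * b) (by linarith)
  -- The squared remainder with its weight decays like `⟨l - ρ⟩^{2b-2}`; this is integrable
  -- precisely because `b < 1/2`.
  obtain ⟨C₃, hC₃t, hC₃⟩ := exists_lintegral_bracketPow_sub_dispersion_le
    (p := 2 - 2 * b) (by linarith)
  obtain ⟨C₄, hC₄t, hC₄⟩ := exists_lintegral_smear_sq_le
  refine ⟨2 * C₂ + 2 * (C₁ ^ 2 * (C₃ * C₄)), by finiteness, fun G hGm hG => ?_⟩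
  have hsm := measurable_smear hGm
  have hm2 : Measurable fun p : ℝ × ℝ => bracketPow (2 * b) (p.2 - dispersion p.1) *
      (C₁ * (bracketPow (-1) (p.2 - dispersion p.1) * smear G p.2)) ^ 2 := by fun_prop
  calc _ ≤ ∫⁻ ξ, ((∫⁻ l, 2 * (bracketPow (2 * b) (l - dispersion ξ) *
          (‖Θ (l - dispersion ξ)‖ₑ * ‖hilbertOp G (dispersion ξ)‖ₑ) ^ 2)) +
        ∫⁻ l, 2 * (bracketPow (2 * b) (l - dispersion ξ) *
          (C₁ * (bracketPow (-1) (l - dispersion ξ) * smear G l)) ^ 2)) := by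
        refine lintegral_mono fun ξ => ?_
        simp only
        rw [← lintegral_add_right _ (by fun_prop)]
        exact lintegral_mono fun l => enorm_sq_le_of_le_add (hC₁ G hG ξ l)
    _ = 2 * (∫⁻ ξ, ∫⁻ l, bracketPow (2 * b) (l - dispersion ξ) *
          (‖Θ (l - dispersion ξ)‖ₑ * ‖hilbertOp G (dispersion ξ)‖ₑ) ^ 2) +
        2 * ∫⁻ ξ, ∫⁻ l, bracketPow (2 * b) (l - dispersion ξ) *
          (C₁ * (bracketPow (-1) (l - dispersion ξ) * smear G l)) ^ 2 := by
        simp only [lintegral_const_mul' (2 : ℝ≥0∞) _ (by norm_num)]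
        rw [lintegral_add_right, lintegral_const_mul' _ _ (by norm_num),
          lintegral_const_mul' _ _ (by norm_num)]
        exact (hm2.lintegral_prod_right' (ν := volume)).const_mul 2
    _ ≤ 2 * (C₂ * ∫⁻ τ, ‖damp G τ‖ₑ ^ 2) +
        2 * (C₁ ^ 2 * (C₃ * (C₄ * ∫⁻ τ, ‖damp G τ‖ₑ ^ 2))) := by
        refine add_le_add (mul_le_mul_right (hC₂ G hG) _) (mul_le_mul_right ?_ _)
        -- `smear G l` does not depend on `ξ`, so integrating in `ξ` first produces exactly the
        -- weight `⟨l⟩^{-2/3}`.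
        rw [lintegral_lintegral_swap hm2.aemeasurable]
        calc _ = ∫⁻ l, C₁ ^ 2 * smear G l ^ 2 *
              ∫⁻ ξ, bracketPow (-(2 - 2 * b)) (l - dispersion ξ) := by
              refine lintegral_congr fun l => ?_
              rw [← lintegral_const_mul _ (by fun_prop)]
              refine lintegral_congr fun ξ => ?_
              have e : bracketPow (-(2 - 2 * b)) (l - dispersion ξ) =
                  bracketPow (2 * b) (l - dispersion ξ) *
                    bracketPow (-1) (l - dispersion ξ) ^ 2 := by
                rw [bracketPow_sq, bracketPow_mul]; ring_nf
              rw [e]; ring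
          _ ≤ ∫⁻ l, C₁ ^ 2 * C₃ * (bracketPow (-(2 / 3)) l * smear G l ^ 2) := by
              refine lintegral_mono fun l => ?_
              calc _ ≤ C₁ ^ 2 * smear G l ^ 2 * (C₃ * bracketPow (-(2 / 3)) l) :=
                    mul_le_mul_right (hC₃ l) _
                _ = _ := by ring
          _ = C₁ ^ 2 * C₃ * ∫⁻ l, bracketPow (-(2 / 3)) l * smear G l ^ 2 :=
              lintegral_const_mul' _ _ (by finiteness)
          _ ≤ C₁ ^ 2 * C₃ * (C₄ * ∫⁻ τ, ‖damp G τ‖ₑ ^ 2) := mul_le_mul_right (hC₄ G hG) _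
          _ = _ := by ring
    _ = _ := by ring

/-- The low-frequency bound for the symbol of the forcing term. -/
theorem exists_lintegral_low_forcingSymbol_le (Θ : 𝓢(ℝ, ℂ)) {α : ℝ} (hα₀ : 0 ≤ α)
    (hα : α ≤ 2 / 3) :
    ∃ C : ℝ≥0∞, C ≠ ⊤ ∧ ∀ G : ℝ → ℂ, Measurable G → MemLp (damp G) 2 volume →
      ∫⁻ ξ in {ξ : ℝ | |ξ| < 1}, ∫⁻ l, bracketPow (2 * α) l * ‖forcingSymbol Θ G ξ l‖ₑ ^ 2 ≤
        C * ∫⁻ τ, ‖damp G τ‖ₑ ^ 2 := by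
  obtain ⟨C₁, hC₁t, hC₁⟩ := exists_enorm_forcingSymbol_le Θ
  obtain ⟨C₂, hC₂t, hC₂⟩ := exists_lintegral_free_part_le Θ (r := 2 * α) (by linarith)
  obtain ⟨C₄, hC₄t, hC₄⟩ := exists_lintegral_smear_sq_le
  set B : ℝ → ℝ≥0∞ := fun r => ENNReal.ofReal (65 ^ r) with hB
  have hBle : ∀ {r ξ : ℝ}, 0 ≤ r → |ξ| < 1 → bracketPow r (dispersion ξ) ≤ B r := by
    intro r ξ hr hξ
    refine ENNReal.ofReal_le_ofReal ?_
    have := (bracket_pos (dispersion ξ)).le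
    gcongr
    exact bracket_dispersion_le hξ
  have hBt : ∀ r, B r ≠ ⊤ := fun r => ENNReal.ofReal_ne_top
  have hB1 := hBt (2 * α)
  have hB2 := hBt 2
  refine ⟨2 * (B (2 * α) * C₂) + 2 * (C₁ ^ 2 * B 2 * C₄ * 2), by finiteness, fun G hGm hG => ?_⟩
  have hsm := measurable_smear hGm
  calc _ ≤ ∫⁻ ξ in {ξ : ℝ | |ξ| < 1},
        (2 * (B (2 * α) * (∫⁻ l, bracketPow (2 * α) (l - dispersion ξ) *
          (‖Θ (l - dispersion ξ)‖ₑ * ‖hilbertOp G (dispersion ξ)‖ₑ) ^ 2)) +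
        2 * (C₁ ^ 2 * B 2 * ∫⁻ l, bracketPow (-(2 / 3)) l * smear G l ^ 2)) := by
        refine setLIntegral_mono' measurableSet_abs_lt_one fun ξ hξ => ?_
        rw [← lintegral_const_mul' _ _ hB1, ← lintegral_const_mul' _ _ (by norm_num),
          ← lintegral_const_mul _ (by fun_prop), ← lintegral_const_mul _ (by fun_prop),
          ← lintegral_add_right _ (by fun_prop)]
        refine lintegral_mono fun l => (enorm_sq_le_of_le_add (hC₁ G hG ξ l)).trans ?_
        refine add_le_add (mul_le_mul_right ?_ _) (mul_le_mul_right ?_ _)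
        · rw [← mul_assoc]
          gcongr
          rw [mul_comm (B (2 * α))]
          exact (bracketPow_le_mul (by linarith) l (dispersion ξ)).trans
            (mul_le_mul_right (hBle (by linarith) hξ) _)
        -- For `|ξ| < 1` the shift by `dispersion ξ` is harmless. The weight becomes `⟨l⟩^{2α-2}`,
        -- at most `⟨l⟩^{-2/3}` because `α ≤ 2/3`.
        · have h2 : bracketPow (-1) (l - dispersion ξ) ^ 2 ≤ B 2 * bracketPow (-2) l := by
            rw [bracketPow_sq]
            norm_num
            refine (bracketPow_neg_sub_le_mul (by norm_num) l (dispersion ξ)).trans ?_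
            gcongr
            exact hBle (by norm_num) hξ
          calc bracketPow (2 * α) l * (C₁ * (bracketPow (-1) (l - dispersion ξ) * smear G l)) ^ 2
              = C₁ ^ 2 * (bracketPow (2 * α) l * bracketPow (-1) (l - dispersion ξ) ^ 2 *
                smear G l ^ 2) := by ring
            _ ≤ C₁ ^ 2 * (bracketPow (2 * α) l * (B 2 * bracketPow (-2) l) * smear G l ^ 2) := by
                gcongr
            _ = C₁ ^ 2 * B 2 * ((bracketPow (2 * α) l * bracketPow (-2) l) * smear G l ^ 2) := by
                ring
            _ ≤ _ := by
                rw [bracketPow_mul]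
                gcongr
                exact bracketPow_mono (by linarith) l
    _ = 2 * (B (2 * α) * ∫⁻ ξ in {ξ : ℝ | |ξ| < 1}, ∫⁻ l, bracketPow (2 * α) (l - dispersion ξ) *
          (‖Θ (l - dispersion ξ)‖ₑ * ‖hilbertOp G (dispersion ξ)‖ₑ) ^ 2) +
        2 * (C₁ ^ 2 * B 2 * (∫⁻ l, bracketPow (-(2 / 3)) l * smear G l ^ 2)) * 2 := by
        rw [lintegral_add_right _ measurable_const, lintegral_const_mul' _ _ (by norm_num),
          lintegral_const_mul' _ _ hB1, setLIntegral_const, volume_abs_lt_one]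
    _ ≤ 2 * (B (2 * α) * (C₂ * ∫⁻ τ, ‖damp G τ‖ₑ ^ 2)) +
        2 * (C₁ ^ 2 * B 2 * (C₄ * ∫⁻ τ, ‖damp G τ‖ₑ ^ 2)) * 2 := by
        have h1 := (setLIntegral_le_lintegral {ξ : ℝ | |ξ| < 1} fun ξ => ∫⁻ l,
          bracketPow (2 * α) (l - dispersion ξ) *
          (‖Θ (l - dispersion ξ)‖ₑ * ‖hilbertOp G (dispersion ξ)‖ₑ) ^ 2).trans (hC₂ G hG)
        have h2 := hC₄ G hG
        refine add_le_add (mul_le_mul_right (mul_le_mul_right h1 _) _)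
          (mul_le_mul_left (mul_le_mul_right (mul_le_mul_right h2 _) _) _)
    _ = _ := by ring

/-! ### The plane as a product -/

/-- The identification of `ℝ × ℝ` with the space-time plane. -/
def planeEquiv : ℝ × ℝ ≃ᵐ Plane :=
  MeasurableEquiv.finTwoArrow.symm.trans (MeasurableEquiv.toLp 2 (Fin 2 → ℝ))

theorem planeEquiv_apply (p : ℝ × ℝ) : planeEquiv p = !₂[p.1, p.2] := by
  ext i
  fin_cases i <;> rfl

theorem measurePreserving_planeEquiv : MeasurePreserving planeEquiv volume volume :=
  (PiLp.volume_preserving_toLp (Fin 2)).comp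
    ((volume_preserving_finTwoArrow ℝ).symm MeasurableEquiv.finTwoArrow)

theorem integral_plane (f : Plane → ℂ) : ∫ z, f z = ∫ p : ℝ × ℝ, f !₂[p.1, p.2] := by
  rw [← measurePreserving_planeEquiv.integral_comp planeEquiv.measurableEmbedding]
  simp only [planeEquiv_apply]

theorem lintegral_plane (f : Plane → ℝ≥0∞) : ∫⁻ z, f z = ∫⁻ p : ℝ × ℝ, f !₂[p.1, p.2] := by
  rw [← measurePreserving_planeEquiv.lintegral_comp_emb planeEquiv.measurableEmbedding]
  simp only [planeEquiv_apply]

theorem integrable_comp_plane {E : Type*} [NormedAddCommGroup E] {f : Plane → E}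
    (hf : Integrable f) : Integrable fun p : ℝ × ℝ => f !₂[p.1, p.2] := by
  have := (measurePreserving_planeEquiv.integrable_comp_emb planeEquiv.measurableEmbedding).mpr hf
  refine this.congr (ae_of_all _ fun p => ?_)
  simp [planeEquiv_apply]

theorem continuous_plane_mk : Continuous fun p : ℝ × ℝ => (!₂[p.1, p.2] : Plane) := by
  refine (PiLp.continuous_toLp 2 _).comp (continuous_pi fun i => ?_)
  fin_cases i <;> simp <;> fun_prop

theorem abs_snd_le_norm_plane (x t : ℝ) : |t| ≤ ‖(!₂[x, t] : Plane)‖ := by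
  simpa using PiLp.norm_apply_le (!₂[x, t] : Plane) 1

theorem abs_fst_le_norm_plane (x t : ℝ) : |x| ≤ ‖(!₂[x, t] : Plane)‖ := by
  simpa using PiLp.norm_apply_le (!₂[x, t] : Plane) 0

/-! ### Phases -/

/-- The phase `e^{2πix}`. -/
def phase (x : ℝ) : ℂ := Complex.exp (2 * Real.pi * Complex.I * x)

theorem phase_add (x y : ℝ) : phase (x + y) = phase x * phase y := by
  rw [phase, phase, phase, ← Complex.exp_add]
  congr 1
  push_cast
  ring

theorem phase_zero : phase 0 = 1 := by simp [phase]

theorem norm_phase (x : ℝ) : ‖phase x‖ = 1 := by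
  rw [phase, show (2 * Real.pi * Complex.I * x : ℂ) = ((2 * Real.pi * x : ℝ) : ℂ) * Complex.I by
    push_cast; ring, Complex.norm_exp_ofReal_mul_I]

@[fun_prop]
theorem continuous_phase : Continuous phase := by unfold phase; fun_prop

theorem airySymbol_eq_phase (t ξ : ℝ) : airySymbol t ξ = phase (t * dispersion ξ) := by
  rw [airySymbol, phase, dispersion]
  congr 1
  push_cast
  ring

theorem fourier_eq_integral_phase (f : ℝ → ℂ) (w : ℝ) : 𝓕 f w = ∫ v, phase (-(v * w)) * f v := by
  rw [Real.fourier_real_eq_integral_exp_smul]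
  refine integral_congr_ae (ae_of_all _ fun v => ?_)
  simp only [phase, smul_eq_mul]
  congr 2
  push_cast
  ring

theorem fourierInv_eq_integral_phase (f : ℝ → ℂ) (w : ℝ) : 𝓕⁻ f w = ∫ v, phase (v * w) * f v := by
  rw [Real.fourierInv_eq']
  refine integral_congr_ae (ae_of_all _ fun v => ?_)
  simp only [phase, smul_eq_mul]
  congr 2
  simp
  ring

theorem fourier_plane_eq_integral_phase (f : Plane → ℂ) (x t : ℝ) :
    𝓕 f !₂[x, t] = ∫ p : ℝ × ℝ, phase (-(p.1 * x + p.2 * t)) * f !₂[p.1, p.2] := by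
  rw [Real.fourier_eq', integral_plane]
  refine integral_congr_ae (ae_of_all _ fun p => ?_)
  simp only [phase, smul_eq_mul]
  congr 2
  simp [PiLp.inner_apply]
  ring

/-! ### The transposed forcing operator in frequency variables -/

/-- By duality the symbol multiplies `𝓕⁻ χ`, and pairing with `δ₀` evaluates a Fourier transform at
`0`, that is, integrates. -/
theorem airyGroup_delta_apply (t : ℝ) (χ : 𝓢(ℝ, ℂ)) :
    airyGroup t (TemperedDistribution.delta (0 : ℝ)) χ =
      ∫ ξ, phase (t * dispersion ξ) * 𝓕⁻ χ ξ := by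
  rw [airyGroup, TemperedDistribution.fourierMultiplierCLM_apply_apply,
    TemperedDistribution.delta_apply, SchwartzMap.fourier_coe, fourier_eq_integral_phase]
  refine integral_congr_ae (ae_of_all _ fun ξ => ?_)
  simp only [mul_zero, neg_zero, phase_zero, one_mul]
  rw [SchwartzMap.smulLeftCLM_apply_apply (hasTemperateGrowth_airySymbol t), airySymbol_eq_phase,
    smul_eq_mul]

theorem integrable_phase_mul_plane (φ : 𝓢(Plane, ℂ)) {f : ℝ × ℝ → ℝ} (hf : Continuous f) :
    Integrable fun p : ℝ × ℝ => phase (f p) * φ !₂[p.1, p.2] := by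
  refine (integrable_comp_plane φ.integrable).bdd_mul (c := 1) (by fun_prop)
    (ae_of_all _ fun p => ?_)
  rw [norm_phase]

theorem exists_norm_plane_le (φ : 𝓢(Plane, ℂ)) :
    ∃ C : ℝ, ∀ ξ l : ℝ, ‖φ !₂[ξ, l]‖ ≤ C * bracket l ^ (-2 : ℝ) := by
  refine ⟨2 ^ 2 * (Finset.Iic (2, 0)).sup (fun m => SchwartzMap.seminorm ℝ m.1 m.2) φ,
    fun ξ l => ?_⟩
  have h := SchwartzMap.one_add_le_sup_seminorm_apply (𝕜 := ℝ) (m := (2, 0)) (k := 2) (n := 0)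
    le_rfl le_rfl φ !₂[ξ, l]
  rw [norm_iteratedFDeriv_zero] at h
  have hb := bracket_pos l
  rw [Real.rpow_neg hb.le, Real.rpow_two, ← div_eq_mul_inv, le_div_iff₀ (by positivity), mul_comm]
  refine le_trans ?_ h
  gcongr
  rw [bracket]
  have := abs_snd_le_norm_plane ξ l
  linarith

theorem continuous_integral_phase_mul {f : ℝ × ℝ → ℂ} (hf : Continuous f) {C : ℝ}
    (hC : ∀ ξ l : ℝ, ‖f (ξ, l)‖ ≤ C * bracket l ^ (-2 : ℝ)) (t : ℝ) :
    Continuous fun ξ => ∫ l, phase (-(l * t)) * f (ξ, l) := by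
  refine continuous_of_dominated (bound := fun l => C * bracket l ^ (-2 : ℝ))
    (fun ξ => Continuous.aestronglyMeasurable (by fun_prop))
    (fun ξ => ae_of_all _ fun l => ?_) ?_ (ae_of_all _ fun l => by fun_prop)
  · rw [norm_mul, norm_phase, one_mul]
    exact hC ξ l
  · exact (integrable_bracket_rpow (by norm_num)).const_mul C

/-- Fourier inversion in the space variable alone. -/
theorem fourierInv_timeSlice (ψ : 𝓢(Plane, ℂ)) (t ξ : ℝ) :
    𝓕⁻ (timeSlice t ψ) ξ = ∫ l, phase (-(l * t)) * (𝓕⁻ ψ) !₂[ξ, l] := by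
  set φ : 𝓢(Plane, ℂ) := 𝓕⁻ ψ with hφ
  have hψ : ψ = 𝓕 φ := by rw [hφ, fourier_fourierInv_eq]
  set h : ℝ → ℂ := fun ξ => ∫ l, phase (-(l * t)) * φ !₂[ξ, l] with hh
  have hint : Integrable fun p : ℝ × ℝ => phase (-(p.2 * t)) * φ !₂[p.1, p.2] :=
    integrable_phase_mul_plane φ (by fun_prop)
  have hcφ : Continuous fun p : ℝ × ℝ => φ !₂[p.1, p.2] := φ.continuous.comp continuous_plane_mk
  have hi : Integrable h := hint.integral_prod_left
  -- Continuity is what makes Fourier inversion for `h` hold at every point.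
  have hc : Continuous h := by
    obtain ⟨C, hC⟩ := exists_norm_plane_le φ
    exact continuous_integral_phase_mul hcφ hC t
  have hF : 𝓕 h = timeSlice t ψ := by
    funext x
    have e1 : timeSlice t ψ x = 𝓕 (φ : Plane → ℂ) !₂[x, t] := by
      rw [← SchwartzMap.fourier_coe, ← hψ]; rfl
    rw [e1, fourier_plane_eq_integral_phase, fourier_eq_integral_phase,
      Measure.volume_eq_prod, integral_prod _ (integrable_phase_mul_plane φ (by fun_prop))]
    refine integral_congr_ae (ae_of_all _ fun ξ => ?_)
    simp only [hh, ← integral_const_mul]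
    refine integral_congr_ae (ae_of_all _ fun l => ?_)
    simp only
    rw [← mul_assoc, ← phase_add]
    congr 2
    ring
  rw [SchwartzMap.fourierInv_coe, ← hF, hc.fourierInv_fourier_eq hi]
  rw [hF]
  exact (timeSlice t ψ).integrable

theorem airyGroup_delta_timeSlice (ψ : 𝓢(Plane, ℂ)) (t' t : ℝ) :
    airyGroup t' (TemperedDistribution.delta (0 : ℝ)) (timeSlice t ψ) =
      ∫ p : ℝ × ℝ, phase (t' * dispersion p.1 - t * p.2) * (𝓕⁻ ψ) !₂[p.1, p.2] := by
  rw [airyGroup_delta_apply, Measure.volume_eq_prod,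
    integral_prod _ (integrable_phase_mul_plane _ (by fun_prop))]
  refine integral_congr_ae (ae_of_all _ fun ξ => ?_)
  simp only [fourierInv_timeSlice, ← integral_const_mul]
  refine integral_congr_ae (ae_of_all _ fun l => ?_)
  simp only
  rw [← mul_assoc, ← phase_add]
  congr 2
  ring

/-- The sign of the oriented interval from `0` to `t` at `s`. -/
def orientedIndicator (s t : ℝ) : ℂ :=
  if 0 < s then (if s < t then 1 else 0) else (if t < s then -1 else 0)

theorem measurable_orientedIndicator :
    Measurable fun p : ℝ × ℝ => orientedIndicator p.1 p.2 := by
  unfold orientedIndicator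
  refine Measurable.ite (measurableSet_lt (by fun_prop) (by fun_prop)) ?_ ?_
  · exact Measurable.ite (measurableSet_lt (by fun_prop) (by fun_prop)) (by fun_prop) (by fun_prop)
  · exact Measurable.ite (measurableSet_lt (by fun_prop) (by fun_prop)) (by fun_prop) (by fun_prop)

theorem norm_orientedIndicator_le (s t : ℝ) : ‖orientedIndicator s t‖ ≤ 1 := by
  unfold orientedIndicator
  split_ifs <;> simp

theorem abs_le_of_orientedIndicator_ne_zero {s t : ℝ} (h : orientedIndicator s t ≠ 0) :
    |s| ≤ |t| := by
  unfold orientedIndicator at h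
  split_ifs at h with h1 h2 h2
  · rw [abs_of_pos h1, abs_of_pos (h1.trans h2)]; exact h2.le
  · exact absurd rfl h
  · rw [abs_of_nonpos (not_lt.mp h1), abs_of_neg (h2.trans_le (not_lt.mp h1))]; linarith
  · exact absurd rfl h

theorem integral_orientedIndicator_mul (f : ℝ → ℂ) (t : ℝ) :
    ∫ s, orientedIndicator s t * f s = ∫ s in (0 : ℝ)..t, f s := by
  rcases le_or_gt 0 t with h | h
  · rw [intervalIntegral.integral_of_le h, integral_Ioc_eq_integral_Ioo,
      ← integral_indicator measurableSet_Ioo]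
    refine integral_congr_ae (ae_of_all _ fun s => ?_)
    simp only [orientedIndicator, Set.indicator, Set.mem_Ioo]
    split_ifs with h1 h2 h3 h3 h2 h3 h3 <;> first | (exfalso; grind) | simp
  · rw [intervalIntegral.integral_of_ge h.le, ← integral_indicator measurableSet_Ioc,
      ← integral_neg]
    refine integral_congr_ae (ae_of_all _ fun s => ?_)
    simp only [orientedIndicator, Set.indicator, Set.mem_Ioc]
    split_ifs with h1 h2 h3 h3 h2 h3 h3 <;> first | (exfalso; grind) | simp

theorem forcingTranspose_eq_integral (θ : ℝ → ℂ) (ψ : 𝓢(Plane, ℂ)) (s : ℝ) :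
    forcingTranspose θ ψ s = ∫ t, orientedIndicator s t * θ t *
      ∫ p : ℝ × ℝ, phase ((t - s) * dispersion p.1 - t * p.2) * (𝓕⁻ ψ) !₂[p.1, p.2] := by
  rw [forcingTranspose]
  simp only [airyGroup_delta_timeSlice]
  split_ifs with h
  · rw [← integral_indicator measurableSet_Ioi]
    refine integral_congr_ae (ae_of_all _ fun t => ?_)
    simp only [orientedIndicator, h, if_true, Set.indicator, Set.mem_Ioi]
    split_ifs <;> simp
  · rw [← integral_indicator measurableSet_Iio, ← integral_neg]
    refine integral_congr_ae (ae_of_all _ fun t => ?_)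
    simp only [orientedIndicator, h, if_false, Set.indicator, Set.mem_Iio]
    split_ifs <;> simp

/-- Since `s` lies between `0` and `t`, the compact support of `θ` confines both variables to a
bounded set. -/
theorem integrable_orientedIndicator_mul {θ : ℝ → ℂ} (hθ : Continuous θ)
    (hθc : HasCompactSupport θ) :
    Integrable fun q : ℝ × ℝ => orientedIndicator q.1 q.2 * θ q.2 := by
  obtain ⟨T, hT⟩ := hθc.isCompact.isBounded.subset_closedBall (0 : ℝ)
  have hi : Integrable (fun q : ℝ × ℝ =>
      (Set.Icc (-T) T).indicator (fun _ => (1 : ℝ)) q.1 * ‖θ q.2‖) := by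
    refine Integrable.mul_prod ?_ (hθ.integrable_of_hasCompactSupport hθc).norm
    exact (integrable_indicator_iff measurableSet_Icc).mpr (integrableOn_const (by simp))
  refine hi.mono' (measurable_orientedIndicator.mul
    (by have := hθ.measurable; fun_prop)).aestronglyMeasurable (ae_of_all _ fun q => ?_)
  obtain ⟨s, t⟩ := q
  simp only [norm_mul]
  by_cases h0 : orientedIndicator s t = 0
  · simp only [h0, norm_zero, zero_mul]
    refine mul_nonneg (Set.indicator_nonneg (fun _ _ => zero_le_one) _) (norm_nonneg _)
  by_cases h1 : θ t = 0
  · simp [h1]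
  have ht : t ∈ Metric.closedBall (0 : ℝ) T := hT (subset_tsupport θ h1)
  rw [mem_closedBall_zero_iff, Real.norm_eq_abs] at ht
  have hs : s ∈ Set.Icc (-T) T := abs_le.mp ((abs_le_of_orientedIndicator_ne_zero h0).trans ht)
  rw [Set.indicator_of_mem hs]
  gcongr
  exact norm_orientedIndicator_le s t

theorem integral_phase_interval {c : ℝ} (hc : c ≠ 0) (t : ℝ) :
    ∫ s in (0 : ℝ)..t, phase (s * c) = (phase (t * c) - 1) / (2 * Real.pi * Complex.I * c) := by
  have hc' : (2 * Real.pi * Complex.I * c : ℂ) ≠ 0 := by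
    have h1 : (Real.pi : ℂ) ≠ 0 := by exact_mod_cast Real.pi_ne_zero
    have h2 : (c : ℂ) ≠ 0 := by exact_mod_cast hc
    simp [h1, h2, Complex.I_ne_zero]
  have e : ∀ s : ℝ, phase (s * c) = Complex.exp (2 * Real.pi * Complex.I * c * s) := fun s => by
    rw [phase]; congr 1; push_cast; ring
  simp only [e]
  rw [integral_exp_mul_complex hc']
  simp

/-- Integrating the phase over `[0, t]` gives a difference of two phases divided by `2πi(τ - ρ)`;
each then contributes one value of `𝓕 θ`. -/
theorem integral_theta_mul_phase_interval {θ : ℝ → ℂ} (hθ : Integrable θ) {ρ τ : ℝ} (l : ℝ)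
    (h : τ ≠ ρ) :
    ∫ t, θ t * phase (t * (ρ - l)) * ∫ s in (0 : ℝ)..t, phase (s * (τ - ρ)) =
      forcingKernel (𝓕 θ) ρ l τ := by
  have hi : ∀ w : ℝ, Integrable fun t => phase (-(t * w)) * θ t := fun w =>
    hθ.bdd_mul (c := 1) (by fun_prop) (ae_of_all _ fun t => (norm_phase _).le)
  rw [forcingKernel, fourier_eq_integral_phase, fourier_eq_integral_phase,
    ← integral_sub (hi _) (hi _), ← integral_div]
  refine integral_congr_ae (ae_of_all _ fun t => ?_)
  simp only
  rw [integral_phase_interval (sub_ne_zero.mpr h), mul_div_assoc', mul_sub, mul_assoc,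
    ← phase_add]
  push_cast
  congr 1
  rw [show t * (ρ - l) + t * (τ - ρ) = -(t * (l - τ)) by ring,
    show t * (ρ - l) = -(t * (l - ρ)) by ring]
  ring

/-- The inverse Fourier transform of the transposed forcing operator. -/
theorem fourierInv_forcingTranspose {θ : ℝ → ℂ} (hθ : Continuous θ) (hθc : HasCompactSupport θ)
    (ψ : 𝓢(Plane, ℂ)) (τ : ℝ) :
    𝓕⁻ (forcingTranspose θ ψ) τ =
      ∫ p : ℝ × ℝ, (𝓕⁻ ψ) !₂[p.1, p.2] * forcingKernel (𝓕 θ) (dispersion p.1) p.2 τ := by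
  set φ : 𝓢(Plane, ℂ) := 𝓕⁻ ψ with hφ
  have hθi : Integrable θ := hθ.integrable_of_hasCompactSupport hθc
  let F : ℝ × ℝ → ℝ × ℝ → ℂ := fun q p =>
    phase (q.1 * τ) * (orientedIndicator q.1 q.2 * θ q.2 *
      (phase ((q.2 - q.1) * dispersion p.1 - q.2 * p.2) * φ !₂[p.1, p.2]))
  -- All phases have modulus one, so Fubini rests on bounded support in `(s, t)` and rapid decay in
  -- `(ξ, l)`.
  have hF : Integrable (Function.uncurry F) (volume.prod volume) := by
    have h1 := (integrable_orientedIndicator_mul hθ hθc).mul_prod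
      (integrable_comp_plane φ.integrable)
    refine (h1.bdd_mul (c := 1) (f := fun z : (ℝ × ℝ) × ℝ × ℝ => phase (z.1.1 * τ +
      ((z.1.2 - z.1.1) * dispersion z.2.1 - z.1.2 * z.2.2))) (by fun_prop)
      (ae_of_all _ fun t => (norm_phase _).le)).congr (ae_of_all _ fun z => ?_)
    simp only [F, Function.uncurry, phase_add]
    ring
  calc 𝓕⁻ (forcingTranspose θ ψ) τ = ∫ s, ∫ t, ∫ p, F (s, t) p := by
        rw [fourierInv_eq_integral_phase]
        refine integral_congr_ae (ae_of_all _ fun s => ?_)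
        simp only [forcingTranspose_eq_integral, F, ← integral_const_mul, ← hφ]
    _ = ∫ q, ∫ p, F q p := (integral_prod _ hF.integral_prod_left).symm
    _ = ∫ p, ∫ q, F q p := integral_integral_swap hF
    _ = ∫ p : ℝ × ℝ, φ !₂[p.1, p.2] * forcingKernel (𝓕 θ) (dispersion p.1) p.2 τ := by
        -- Injectivity of `dispersion` leaves at most one exceptional `ξ`.
        have hne : ∀ᵐ ξ : ℝ, τ ≠ dispersion ξ := by
          have : {ξ : ℝ | dispersion ξ = τ}.Subsingleton := fun x hx y hy =>
            injective_dispersion (hx.trans hy.symm)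
          filter_upwards [this.finite.countable.ae_notMem volume] with ξ hξ h
          exact hξ h.symm
        have hne' : ∀ᵐ p : ℝ × ℝ, τ ≠ dispersion p.1 :=
          Measure.quasiMeasurePreserving_fst.ae hne
        refine integral_congr_ae ?_
        filter_upwards [hne'] with p hp
        have hFp : Integrable (fun q => F q p) (volume.prod volume) := by
          refine (((integrable_orientedIndicator_mul hθ hθc).bdd_mul (c := 1)
            (f := fun q : ℝ × ℝ => phase (q.1 * τ +
              ((q.2 - q.1) * dispersion p.1 - q.2 * p.2))) (by fun_prop)
            (ae_of_all _ fun t => (norm_phase _).le)).mul_const (φ !₂[p.1, p.2])).congr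
            (ae_of_all _ fun q => ?_)
          simp only [F, phase_add]
          ring
        rw [Measure.volume_eq_prod, integral_prod_symm _ hFp,
          ← integral_theta_mul_phase_interval hθi p.2 hp, ← integral_const_mul]
        refine integral_congr_ae (ae_of_all _ fun t => ?_)
        simp only [← integral_orientedIndicator_mul, ← integral_const_mul]
        refine integral_congr_ae (ae_of_all _ fun s => ?_)
        simp only [F]
        have e : phase (s * τ) * phase ((t - s) * dispersion p.1 - t * p.2) =
            phase (t * (dispersion p.1 - p.2)) * phase (s * (τ - dispersion p.1)) := by
          rw [← phase_add, ← phase_add]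
          congr 1
          ring
        linear_combination (orientedIndicator s t * θ t * φ !₂[p.1, p.2]) * e

/-! ### The forcing term as a tempered distribution -/

/-- Decay `⟨τ⟩⁻¹` is just enough to pair with `G`; the polynomial growth in `ρ` and `l` is absorbed
by a Schwartz test function. -/
theorem exists_enorm_forcingKernel_le (Θ : 𝓢(ℝ, ℂ)) :
    ∃ C : ℝ≥0∞, C ≠ ⊤ ∧ ∀ ρ l τ, ‖forcingKernel Θ ρ l τ‖ₑ ≤
      bracketPow (-1) τ * (C * (bracketPow 1 ρ + bracketPow 1 l)) := by
  obtain ⟨C₁, hC₁t, hC₁⟩ := exists_enorm_forcingKernel_add_le Θ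
  obtain ⟨C₂, hC₂t, hC₂⟩ := exists_enorm_le_bracketPow Θ
  refine ⟨C₁ + C₂, by finiteness, fun ρ l τ => ?_⟩
  have h1 : ∀ {r : ℝ} (x : ℝ), r ≤ 0 → bracketPow r x ≤ 1 := fun x hr =>
    (bracketPow_mono hr x).trans (bracketPow_zero x).le
  have hA : ‖forcingKernel Θ ρ l τ + Θ (l - ρ) * hilbertKernel (τ - ρ)‖ₑ ≤
      C₁ * (bracketPow 1 l * bracketPow (-1) τ) := by
    refine (hC₁ ρ l τ).trans ?_
    calc C₁ * bracketPow (-1) (l - ρ) * bracketPow (-3) (l - τ)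
        ≤ C₁ * 1 * (bracketPow 1 l * bracketPow (-1) τ) := by
          gcongr
          · exact h1 _ (by norm_num)
          · rw [bracketPow_sub_comm]
            exact (bracketPow_mono (by norm_num) _).trans
              (bracketPow_neg_sub_le_mul zero_le_one τ l)
      _ = _ := by ring
  have hB : ‖Θ (l - ρ) * hilbertKernel (τ - ρ)‖ₑ ≤ C₂ * (bracketPow 1 ρ * bracketPow (-1) τ) := by
    rw [enorm_mul]
    calc _ ≤ C₂ * 1 * (bracketPow 1 ρ * bracketPow (-1) τ) := by
          gcongr
          · exact (hC₂ _).trans (by gcongr; exact h1 _ (by norm_num))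
          · exact enorm_hilbertKernel_sub_le ρ τ
      _ = _ := by ring
  calc ‖forcingKernel Θ ρ l τ‖ₑ
      = ‖(forcingKernel Θ ρ l τ + Θ (l - ρ) * hilbertKernel (τ - ρ)) -
          Θ (l - ρ) * hilbertKernel (τ - ρ)‖ₑ := by rw [add_sub_cancel_right]
    _ ≤ C₁ * (bracketPow 1 l * bracketPow (-1) τ) + C₂ * (bracketPow 1 ρ * bracketPow (-1) τ) :=
        enorm_sub_le.trans (add_le_add hA hB)
    _ ≤ (C₁ + C₂) * (bracketPow 1 l * bracketPow (-1) τ) +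
        (C₁ + C₂) * (bracketPow 1 ρ * bracketPow (-1) τ) := by
        gcongr <;> simp
    _ = _ := by ring

theorem lintegral_enorm_mul_bracketPow_plane_lt_top (φ : 𝓢(Plane, ℂ)) :
    ∫⁻ p : ℝ × ℝ, ‖φ !₂[p.1, p.2]‖ₑ * (bracketPow 1 (dispersion p.1) + bracketPow 1 p.2) < ⊤ := by
  have hi : Integrable fun z : Plane => 2 * (‖z‖ ^ 0 * ‖φ z‖) + 64 * (‖z‖ ^ 3 * ‖φ z‖) +
      ‖z‖ ^ 1 * ‖φ z‖ :=
    (((φ.integrable_pow_mul volume 0).const_mul 2).add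
      ((φ.integrable_pow_mul volume 3).const_mul 64)).add (φ.integrable_pow_mul volume 1)
  refine lt_of_le_of_lt (lintegral_mono fun p => ?_) (integrable_comp_plane hi).2
  obtain ⟨x, l⟩ := p
  simp only
  have h1 := bracket_pos (dispersion x)
  have h2 := bracket_pos l
  rw [← ofReal_norm, bracketPow, bracketPow, Real.rpow_one, Real.rpow_one,
    ← ENNReal.ofReal_add h1.le h2.le, ← ENNReal.ofReal_mul (norm_nonneg _), ← ofReal_norm]
  refine ENNReal.ofReal_le_ofReal (le_trans ?_ (le_abs_self _))
  set z : Plane := !₂[x, l] with hz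
  have hx : |x| ≤ ‖z‖ := abs_fst_le_norm_plane x l
  have hl : |l| ≤ ‖z‖ := abs_snd_le_norm_plane x l
  have hd : bracket (dispersion x) ≤ 1 + 64 * ‖z‖ ^ 3 := by
    have hpi := Real.pi_le_four
    have h0 := Real.pi_pos
    rw [bracket, dispersion, abs_mul, abs_pow, abs_pow, abs_of_pos (by positivity)]
    have : (2 * Real.pi) ^ 2 ≤ 64 := by nlinarith
    gcongr
  have hbl : bracket l ≤ 1 + ‖z‖ := by rw [bracket]; linarith
  calc ‖φ z‖ * (bracket (dispersion x) + bracket l)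
      ≤ ‖φ z‖ * ((1 + 64 * ‖z‖ ^ 3) + (1 + ‖z‖)) := by gcongr
    _ = _ := by ring

/-- Absolute integrability in `(τ, ξ, l)`, which permits Fubini in the pairing of `g` with the
transposed operator. -/
theorem integrable_mul_forcingKernel (Θ : 𝓢(ℝ, ℂ)) {G : ℝ → ℂ} (hGm : Measurable G)
    (hG : MemLp (damp G) 2 volume) (φ : 𝓢(Plane, ℂ)) :
    Integrable (fun q : ℝ × ℝ × ℝ => G q.1 * (φ !₂[q.2.1, q.2.2] *
      forcingKernel Θ (dispersion q.2.1) q.2.2 q.1)) (volume.prod volume) := by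
  obtain ⟨C, hCt, hC⟩ := exists_enorm_forcingKernel_le Θ
  have hφm : Measurable fun p : ℝ × ℝ => φ !₂[p.1, p.2] :=
    (φ.continuous.comp continuous_plane_mk).measurable
  have hkm : Measurable fun q : ℝ × ℝ × ℝ => forcingKernel Θ (dispersion q.2.1) q.2.2 q.1 :=
    (measurable_forcingKernel Θ.continuous.measurable).comp
      (by fun_prop : Measurable fun q : ℝ × ℝ × ℝ => (dispersion q.2.1, q.2.2, q.1))
  refine ⟨((hGm.comp measurable_fst).mul
    ((hφm.comp measurable_snd).mul hkm)).aestronglyMeasurable, ?_⟩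
  rw [hasFiniteIntegral_iff_enorm]
  calc _ ≤ ∫⁻ q : ℝ × ℝ × ℝ, (bracketPow (-1) q.1 * ‖G q.1‖ₑ) *
        (C * (‖φ !₂[q.2.1, q.2.2]‖ₑ * (bracketPow 1 (dispersion q.2.1) + bracketPow 1 q.2.2)))
        ∂(volume.prod volume) := by
        refine lintegral_mono fun q => ?_
        rw [enorm_mul, enorm_mul]
        calc _ ≤ ‖G q.1‖ₑ * (‖φ !₂[q.2.1, q.2.2]‖ₑ * (bracketPow (-1) q.1 *
              (C * (bracketPow 1 (dispersion q.2.1) + bracketPow 1 q.2.2)))) := by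
              gcongr; exact hC _ _ _
          _ = _ := by ring
    _ = (∫⁻ τ, bracketPow (-1) τ * ‖G τ‖ₑ) * ∫⁻ p : ℝ × ℝ, C * (‖φ !₂[p.1, p.2]‖ₑ *
        (bracketPow 1 (dispersion p.1) + bracketPow 1 p.2)) :=
        lintegral_prod_mul (f := fun τ => bracketPow (-1) τ * ‖G τ‖ₑ)
          (g := fun p : ℝ × ℝ => C * (‖φ !₂[p.1, p.2]‖ₑ *
            (bracketPow 1 (dispersion p.1) + bracketPow 1 p.2))) (by fun_prop) (by fun_prop)
    _ < ⊤ := by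
        rw [lintegral_const_mul' _ _ hCt]
        exact ENNReal.mul_lt_top (lintegral_bracketPow_neg_one_mul_lt_top hG)
          (ENNReal.mul_lt_top hCt.lt_top (lintegral_enorm_mul_bracketPow_plane_lt_top φ))

/-- The symbol of the forcing term as a function on the plane. -/
def planeSymbol (Θ G : ℝ → ℂ) (z : Plane) : ℂ := forcingSymbol Θ G (z 0) (z 1)

theorem planeSymbol_mk (Θ G : ℝ → ℂ) (x l : ℝ) :
    planeSymbol Θ G !₂[x, l] = forcingSymbol Θ G x l := rfl

theorem measurable_planeSymbol {Θ G : ℝ → ℂ} (hΘ : Measurable Θ) (hG : Measurable G) :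
    Measurable (planeSymbol Θ G) := by
  have h : Measurable fun z : Plane => (z 0, z 1) := by fun_prop
  have e : planeSymbol Θ G = (fun p : ℝ × ℝ => forcingSymbol Θ G p.1 p.2) ∘
      fun z : Plane => (z 0, z 1) := by
    funext z
    rw [Function.comp_apply, planeSymbol]
  rw [e]
  exact (measurable_forcingSymbol hΘ hG).comp h

theorem lintegral_plane_iterated {f : Plane → ℝ≥0∞} (hf : Measurable f) :
    ∫⁻ z, f z = ∫⁻ ξ, ∫⁻ l, f !₂[ξ, l] := by
  rw [lintegral_plane, Measure.volume_eq_prod, lintegral_prod]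
  exact (hf.comp continuous_plane_mk.measurable).aemeasurable

/-- The `X_b` estimate at `b = 0` is an `L²` estimate. -/
theorem memLp_planeSymbol (Θ : 𝓢(ℝ, ℂ)) {G : ℝ → ℂ} (hGm : Measurable G)
    (hG : MemLp (damp G) 2 volume) : MemLp (planeSymbol Θ G) 2 volume := by
  have hm := measurable_planeSymbol Θ.continuous.measurable hGm
  refine ⟨hm.aestronglyMeasurable, ?_⟩
  obtain ⟨C, hCt, hC⟩ := exists_lintegral_forcingSymbol_le Θ (b := 0) (by norm_num)
  have h : eLpNorm (planeSymbol Θ G) 2 volume ^ 2 < ⊤ := by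
    rw [← lintegral_enorm_sq_eq_eLpNorm, lintegral_plane_iterated (by fun_prop)]
    have := hC G hGm hG
    simp only [mul_zero, bracketPow_zero, one_mul] at this
    refine this.trans_lt (ENNReal.mul_lt_top hCt.lt_top ?_)
    rw [lintegral_enorm_sq_eq_eLpNorm]
    exact ENNReal.pow_lt_top hG.2
  exact (ENNReal.pow_lt_top_iff.mp h).resolve_right (by norm_num)

theorem IsGivenBy.congr_ae {E : Type*} [NormedAddCommGroup E] [InnerProductSpace ℝ E]
    [FiniteDimensional ℝ E] [MeasurableSpace E] [BorelSpace E] {f : 𝓢'(E, ℂ)} {F₁ F₂ : E → ℂ}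
    (h : IsGivenBy f F₁) (e : F₁ =ᵐ[volume] F₂) : IsGivenBy f F₂ := by
  refine ⟨h.1.congr e, fun φ => ?_⟩
  have e' : (fun x => φ x * F₁ x) =ᵐ[volume] fun x => φ x * F₂ x := by
    filter_upwards [e] with x hx
    rw [hx]
  exact ⟨(h.2 φ).1.congr e', (h.2 φ).2.trans (integral_congr_ae e')⟩

/-- The forcing term, defined through its Fourier transform. -/
theorem exists_isForcingTerm {θ : ℝ → ℂ} (hθ : Continuous θ) (hθc : HasCompactSupport θ)
    {Θ : 𝓢(ℝ, ℂ)} (hΘ : 𝓕 θ = Θ) {g : 𝓢'(ℝ, ℂ)} {G : ℝ → ℂ} (hgG : IsGivenBy (𝓕 g) G)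
    (hGm : Measurable G) (hG : MemLp (damp G) 2 volume) :
    ∃ u : 𝓢'(Plane, ℂ), IsForcingTerm θ g u ∧ IsGivenBy (𝓕 u) (planeSymbol Θ G) := by
  have hU := memLp_planeSymbol Θ hGm hG
  -- The distribution `u` is the inverse transform of the `L²` symbol; that it is the forcing term
  -- is then checked by testing.
  have hgiven : IsGivenBy (𝓕 (𝓕⁻ ((hU.toLp _ : Lp ℂ 2 (volume : Measure Plane)) : 𝓢'(Plane, ℂ))))
      (planeSymbol Θ G) := by
    rw [fourier_fourierInv_eq]
    exact (isGivenBy_toTemperedDistribution _).congr_ae hU.coeFn_toLp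
  refine ⟨_, ⟨G, hgG, fun ψ => ?_⟩, hgiven⟩
  have hint := integrable_mul_forcingKernel Θ hGm hG (𝓕⁻ ψ)
  have e : ∀ τ, G τ * 𝓕⁻ (forcingTranspose θ ψ) τ = ∫ p : ℝ × ℝ, G τ * ((𝓕⁻ ψ) !₂[p.1, p.2] *
      forcingKernel Θ (dispersion p.1) p.2 τ) := fun τ => by
    rw [fourierInv_forcingTranspose hθ hθc, hΘ, integral_const_mul]
  simp only [e]
  refine ⟨hint.integral_prod_left, ?_⟩
  rw [integral_integral_swap hint]
  have hu := (hgiven.2 (𝓕⁻ ψ)).2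
  rw [TemperedDistribution.fourier_apply, fourier_fourierInv_eq] at hu
  rw [hu, integral_plane]
  refine integral_congr_ae (ae_of_all _ fun p => ?_)
  simp only [planeSymbol_mk, forcingSymbol, ← integral_const_mul]
  refine integral_congr_ae (ae_of_all _ fun τ => ?_)
  simp only
  ring

/-! ### The Sobolev datum -/

/-- Membership says that `(1 + τ²)^{-1/6} 𝓕 g` is some `f ∈ L²`. Dividing by this smooth weight
recovers `𝓕 g` as a function, and `1 + τ² ≤ ⟨τ⟩²` compares the two weights. -/
theorem exists_isGivenBy_fourier_of_memSobolev {g : 𝓢'(ℝ, ℂ)}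
    (hg : TemperedDistribution.MemSobolev (-1 / 3) 2 g) :
    ∃ G : ℝ → ℂ, IsGivenBy (𝓕 g) G ∧ Measurable G ∧ MemLp (damp G) 2 volume := by
  obtain ⟨f, hf⟩ := TemperedDistribution.memSobolev_iff_exists_smulLeftCLM_fourier.mp hg
  let w : ℝ → ℂ := fun x => (((1 + ‖x‖ ^ 2) ^ (1 / 6 : ℝ) : ℝ) : ℂ)
  have hw : w.HasTemperateGrowth := by fun_prop
  have hwc : Continuous w := hw.1.continuous
  have hinv : 𝓕 g = TemperedDistribution.smulLeftCLM ℂ w (f : 𝓢'(ℝ, ℂ)) := by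
    rw [← hf, TemperedDistribution.smulLeftCLM_smulLeftCLM_apply (by fun_prop) hw]
    have : ((fun x : ℝ => (((1 + ‖x‖ ^ 2) ^ (-1 / 3 / 2 : ℝ) : ℝ) : ℂ)) * w) = fun _ => 1 := by
      funext x
      simp only [Pi.mul_apply, w]
      rw [← Complex.ofReal_mul, ← Real.rpow_add (by positivity)]
      norm_num
    rw [this, TemperedDistribution.smulLeftCLM_const, one_smul]
  have hfm : Measurable f := (Lp.stronglyMeasurable f).measurable
  have hgm : Measurable fun x => w x * f x := hwc.measurable.mul hfm
  refine ⟨fun x => w x * f x, ⟨?_, fun φ => ?_⟩, hgm, ?_⟩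
  · exact ((Lp.memLp f).locallyIntegrable (by norm_num)).continuous_mul hwc
  · have h := (isGivenBy_toTemperedDistribution f).2 (SchwartzMap.smulLeftCLM ℂ w φ)
    have e : ∀ x, SchwartzMap.smulLeftCLM ℂ w φ x * f x = φ x * (w x * f x) := fun x => by
      rw [SchwartzMap.smulLeftCLM_apply_apply hw, smul_eq_mul]
      ring
    simp only [e] at h
    rw [hinv, TemperedDistribution.smulLeftCLM_apply_apply]
    exact h
  · refine (Lp.memLp f).mono ?_ (ae_of_all _ fun x => ?_)
    · unfold damp
      exact Measurable.aestronglyMeasurable (by fun_prop)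
    · have hb := bracket_pos x
      rw [damp, ← mul_assoc, norm_mul]
      refine mul_le_of_le_one_left (norm_nonneg _) ?_
      simp only [w]
      rw [← Complex.ofReal_mul, Complex.norm_real, Real.norm_of_nonneg (by positivity),
        Real.rpow_neg hb.le, inv_mul_le_one₀ (by positivity)]
      calc (1 + ‖x‖ ^ 2) ^ (1 / 6 : ℝ) ≤ (bracket x ^ 2) ^ (1 / 6 : ℝ) := by
            gcongr
            rw [bracket, Real.norm_eq_abs]
            nlinarith [abs_nonneg x]
        _ = bracket x ^ (1 / 3 : ℝ) := by
            rw [← Real.rpow_natCast, ← Real.rpow_mul hb.le]; norm_num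

/-! ### Rescaling of the frequency variables -/

theorem lintegral_eq_mul_lintegral_two_pi_smul {E : Type*} [NormedAddCommGroup E]
    [InnerProductSpace ℝ E] [FiniteDimensional ℝ E] [MeasurableSpace E] [BorelSpace E]
    (f : E → ℝ≥0∞) :
    ∫⁻ z, f z = ENNReal.ofReal ((2 * Real.pi) ^ Module.finrank ℝ E) *
      ∫⁻ z, f ((2 * Real.pi) • z) := by
  have h0 : (2 * Real.pi) ≠ 0 := by have := Real.pi_pos; positivity
  have hp : 0 < (2 * Real.pi) ^ Module.finrank ℝ E := by have := Real.pi_pos; positivity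
  have h := (measurableEmbedding_const_smul₀ (α := E) h0).lintegral_map (μ := volume) f
  rw [Measure.map_addHaar_smul volume h0, lintegral_smul_measure, smul_eq_mul] at h
  rw [← h, ← mul_assoc, abs_of_pos (inv_pos.mpr hp), ← ENNReal.ofReal_mul hp.le,
    mul_inv_cancel₀ hp.ne', ENNReal.ofReal_one, one_mul]

theorem one_add_two_pi_mul_abs_le (x : ℝ) : 1 + |2 * Real.pi * x| ≤ 2 * Real.pi * bracket x := by
  have := Real.pi_gt_three
  rw [abs_mul, abs_of_pos (by positivity), bracket]
  nlinarith

theorem ofReal_one_add_two_pi_rpow_le {r : ℝ} (hr : 0 ≤ r) (x : ℝ) :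
    ENNReal.ofReal ((1 + |2 * Real.pi * x|) ^ r) ≤
      ENNReal.ofReal ((2 * Real.pi) ^ r) * bracketPow r x := by
  have hpi := Real.pi_pos
  have hb := bracket_pos x
  rw [bracketPow, ← ENNReal.ofReal_mul (by positivity), ← Real.mul_rpow (by positivity) hb.le]
  refine ENNReal.ofReal_le_ofReal ?_
  gcongr
  exact one_add_two_pi_mul_abs_le x

/-- Any function competing in the infimum agrees a.e. with `G` after rescaling, so it is enough to
bound each competitor from below. -/
theorem lintegral_damp_sq_rpow_le_sobolevENorm {g : 𝓢'(ℝ, ℂ)} {G : ℝ → ℂ}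
    (hgG : IsGivenBy (𝓕 g) G) :
    (∫⁻ τ, ‖damp G τ‖ₑ ^ 2) ^ (1 / 2 : ℝ) ≤ sobolevENorm (-1 / 3) g := by
  refine le_iInf₂ fun G' hG' => ENNReal.rpow_le_rpow ?_ (by norm_num)
  have hae : (fun τ => G' ((2 * Real.pi) • τ)) =ᵐ[volume] G := IsGivenBy.ae_eq hG' hgG
  have hpi := Real.pi_gt_three
  rw [lintegral_eq_mul_lintegral_two_pi_smul
      (fun ξ : ℝ => ENNReal.ofReal ((1 + |ξ|) ^ (2 * (-1 / 3) : ℝ)) * ‖G' ξ‖ₑ ^ 2),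
    ← lintegral_const_mul' _ _ ENNReal.ofReal_ne_top]
  refine lintegral_mono_ae ?_
  filter_upwards [hae] with τ hτ
  have hb := bracket_pos τ
  simp only [Module.finrank_self, pow_one]
  rw [hτ, enorm_damp, mul_pow, bracketPow_sq, ← mul_assoc,
    ← ENNReal.ofReal_mul (by positivity), bracketPow, smul_eq_mul]
  gcongr
  have h1 : (2 * Real.pi * bracket τ) ^ (2 * (-1 / 3) : ℝ) ≤
      (1 + |2 * Real.pi * τ|) ^ (2 * (-1 / 3) : ℝ) :=
    Real.rpow_le_rpow_of_nonpos (by positivity) (one_add_two_pi_mul_abs_le τ) (by norm_num)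
  -- The Jacobian `2π` outweighs the loss `(2π)^{-2/3}` from the weight; no constant appears.
  have h2 : 1 ≤ 2 * Real.pi * (2 * Real.pi) ^ (2 * (-1 / 3) : ℝ) := by
    have : 2 * Real.pi * (2 * Real.pi) ^ (2 * (-1 / 3) : ℝ) = (2 * Real.pi) ^ (1 / 3 : ℝ) := by
      nth_rewrite 1 [← Real.rpow_one (2 * Real.pi)]
      rw [← Real.rpow_add (by positivity)]
      norm_num
    rw [this]
    exact Real.one_le_rpow (by linarith) (by norm_num)
  calc bracket τ ^ (2 * -(1 / 3) : ℝ)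
      ≤ (2 * Real.pi * (2 * Real.pi) ^ (2 * (-1 / 3) : ℝ)) * bracket τ ^ (2 * -(1 / 3) : ℝ) :=
        le_mul_of_one_le_left (by positivity) h2
    _ = 2 * Real.pi * (2 * Real.pi * bracket τ) ^ (2 * (-1 / 3) : ℝ) := by
        rw [Real.mul_rpow (by positivity) hb.le]
        norm_num
        ring
    _ ≤ _ := by gcongr

theorem two_pi_mul_sub_cube (ξ l : ℝ) :
    2 * Real.pi * l - (2 * Real.pi * ξ) ^ 3 = 2 * Real.pi * (l - dispersion ξ) := by
  rw [dispersion]; ring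

/-- The `X_b` norm of a distribution whose Fourier transform is the symbol of a forcing term. -/
theorem exists_bourgainENorm_le (Θ : 𝓢(ℝ, ℂ)) {α b : ℝ} (hα₀ : 0 ≤ α) (hα : α ≤ 2 / 3)
    (hb₀ : 0 ≤ b) (hb : b < 1 / 2) :
    ∃ C : ℝ≥0∞, C ≠ ⊤ ∧ ∀ G : ℝ → ℂ, Measurable G → MemLp (damp G) 2 volume →
      ∀ u : 𝓢'(Plane, ℂ), IsGivenBy (𝓕 u) (planeSymbol Θ G) →
        bourgainENorm α b u ≤ C * (∫⁻ τ, ‖damp G τ‖ₑ ^ 2) ^ (1 / 2 : ℝ) := by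
  obtain ⟨C₁, hC₁t, hC₁⟩ := exists_lintegral_forcingSymbol_le Θ hb
  obtain ⟨C₂, hC₂t, hC₂⟩ := exists_lintegral_low_forcingSymbol_le Θ hα₀ hα
  set J : ℝ≥0∞ := ENNReal.ofReal ((2 * Real.pi) ^ Module.finrank ℝ Plane) with hJ
  have hJt : J ≠ ⊤ := ENNReal.ofReal_ne_top
  set P : ℝ → ℝ≥0∞ := fun r => ENNReal.ofReal ((2 * Real.pi) ^ r) with hP
  have hPt : ∀ r, P r ≠ ⊤ := fun r => ENNReal.ofReal_ne_top
  have hP1 := hPt (2 * b)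
  have hP2 := hPt (2 * α)
  refine ⟨(J * (P (2 * b) * C₁)) ^ (1 / 2 : ℝ) + (J * (P (2 * α) * C₂)) ^ (1 / 2 : ℝ),
    by finiteness, fun G hGm hG u hu => ?_⟩
  have h2pi : (2 * Real.pi) ≠ 0 := by have := Real.pi_pos; positivity
  have hUm := measurable_planeSymbol Θ.continuous.measurable hGm
  -- The change from Mathlib's frequency variables to those of the `X_b` norm.
  let F : Plane → ℂ := fun z => planeSymbol Θ G ((2 * Real.pi)⁻¹ • z)
  have hF : ∀ z, F ((2 * Real.pi) • z) = planeSymbol Θ G z := fun z => by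
    simp only [F, inv_smul_smul₀ h2pi]
  have hFu : HasFourierTransform u F := by
    unfold HasFourierTransform
    simp only [hF]
    exact hu
  refine (iInf₂_le F hFu).trans ?_
  rw [add_mul, ← ENNReal.mul_rpow_of_nonneg _ _ (by norm_num),
    ← ENNReal.mul_rpow_of_nonneg _ _ (by norm_num)]
  refine add_le_add (ENNReal.rpow_le_rpow ?_ (by norm_num))
    (ENNReal.rpow_le_rpow ?_ (by norm_num))
  · rw [lintegral_eq_mul_lintegral_two_pi_smul]
    simp only [hF, PiLp.smul_apply, smul_eq_mul, two_pi_mul_sub_cube]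
    rw [mul_assoc J, mul_assoc (P _)]
    refine mul_le_mul_right ?_ _
    calc _ ≤ ∫⁻ z : Plane, P (2 * b) *
          (bracketPow (2 * b) (z 1 - dispersion (z 0)) * ‖planeSymbol Θ G z‖ₑ ^ 2) := by
          refine lintegral_mono fun z => ?_
          rw [← mul_assoc]
          gcongr
          exact ofReal_one_add_two_pi_rpow_le (by linarith) _
      _ = P (2 * b) * ∫⁻ z : Plane,
          (bracketPow (2 * b) (z 1 - dispersion (z 0)) * ‖planeSymbol Θ G z‖ₑ ^ 2) :=
          lintegral_const_mul' _ _ hP1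
      _ ≤ _ := by
          refine mul_le_mul_right ?_ _
          rw [lintegral_plane_iterated (by fun_prop)]
          exact hC₁ G hGm hG
  · have hS : MeasurableSet {z : Plane | |z 0| < 1} :=
      measurableSet_lt (by fun_prop) (by fun_prop)
    rw [← lintegral_indicator hS, lintegral_eq_mul_lintegral_two_pi_smul]
    rw [mul_assoc J, mul_assoc (P _)]
    refine mul_le_mul_right ?_ _
    calc _ ≤ ∫⁻ z : Plane, P (2 * α) * Set.indicator {z : Plane | |z 0| < 1}
          (fun z => bracketPow (2 * α) (z 1) * ‖planeSymbol Θ G z‖ₑ ^ 2) z := by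
          refine lintegral_mono fun z => ?_
          by_cases hz : (2 * Real.pi) • z ∈ {z : Plane | |z 0| < 1}
          -- The condition `|2π ξ| < 1` is stronger than `|ξ| < 1`, so enlarging the domain loses
          -- nothing.
          · have hz' : z ∈ {z : Plane | |z 0| < 1} := by
              have h3 := Real.pi_gt_three
              have h : |2 * Real.pi * z 0| < 1 := hz
              rw [abs_mul, abs_of_pos (by positivity)] at h
              have := abs_nonneg (z 0)
              change |z 0| < 1
              nlinarith
            rw [Set.indicator_of_mem hz, Set.indicator_of_mem hz', hF, ← mul_assoc]
            simp only [PiLp.smul_apply, smul_eq_mul]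
            gcongr
            exact ofReal_one_add_two_pi_rpow_le (by linarith) _
          · rw [Set.indicator_of_notMem hz]
            exact zero_le
      _ = P (2 * α) * ∫⁻ z : Plane, Set.indicator {z : Plane | |z 0| < 1}
          (fun z => bracketPow (2 * α) (z 1) * ‖planeSymbol Θ G z‖ₑ ^ 2) z :=
          lintegral_const_mul' _ _ hP2
      _ ≤ _ := by
          refine mul_le_mul_right ?_ _
          rw [lintegral_plane_iterated (Measurable.indicator (by fun_prop) hS)]
          refine le_trans (le_of_eq ?_) (hC₂ G hGm hG)
          rw [← lintegral_indicator measurableSet_abs_lt_one]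
          refine lintegral_congr fun ξ => ?_
          by_cases hξ : |ξ| < 1
          · rw [Set.indicator_of_mem (show ξ ∈ {ξ : ℝ | |ξ| < 1} from hξ)]
            refine lintegral_congr fun l => ?_
            rw [Set.indicator_of_mem (show !₂[ξ, l] ∈ {z : Plane | |z 0| < 1} from hξ)]
            rfl
          · rw [Set.indicator_of_notMem (show ξ ∉ {ξ : ℝ | |ξ| < 1} from hξ)]
            refine (lintegral_congr fun l => ?_).trans lintegral_zero
            exact Set.indicator_of_notMem (show !₂[ξ, l] ∉ {z : Plane | |z 0| < 1} from hξ) _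

end

end BoundaryForcing

/-! ### The boundary forcing estimate. -/

theorem lemma5p3 (α b : ℝ) (hα₁ : 1 / 2 < α) (hα₂ : α < 2 / 3) (hb₁ : 0 < b) (hb₂ : b < 1 / 2)
    (θ : ℝ → ℂ) (hθ : ContDiff ℝ ∞ θ) (hθc : HasCompactSupport θ) :
    ∃ C : ℝ≥0, ∀ g : 𝓢'(ℝ, ℂ), TemperedDistribution.MemSobolev (-1 / 3) 2 g →
      ∃ u : 𝓢'(BoundaryForcing.Plane, ℂ), BoundaryForcing.IsForcingTerm θ g u ∧
        BoundaryForcing.MemBourgain α b u ∧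
        BoundaryForcing.bourgainENorm α b u ≤
          C * BoundaryForcing.sobolevENorm (-1 / 3) g := by
  obtain ⟨C, hCt, hC⟩ := BoundaryForcing.exists_bourgainENorm_le (𝓕 (hθc.toSchwartzMap hθ))
    (α := α) (b := b) (by linarith) hα₂.le hb₁.le hb₂
  refine ⟨C.toNNReal, fun g hg => ?_⟩
  obtain ⟨G, hgG, hGm, hG⟩ := BoundaryForcing.exists_isGivenBy_fourier_of_memSobolev hg
  obtain ⟨u, hu, hUu⟩ := BoundaryForcing.exists_isForcingTerm hθ.continuous hθc
    (Θ := 𝓕 (hθc.toSchwartzMap hθ)) rfl hgG hGm hG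
  have hle := hC G hGm hG u hUu
  -- Membership in `X_b` comes from finiteness of the weighted `L²` norm of `G`; comparison with the
  -- Sobolev norm is needed only for the estimate.
  refine ⟨u, hu, hle.trans_lt (ENNReal.mul_lt_top hCt.lt_top ?_), hle.trans ?_⟩
  · rw [BoundaryForcing.lintegral_enorm_sq_eq_eLpNorm]
    exact ENNReal.rpow_lt_top_of_nonneg (by norm_num) (ENNReal.pow_lt_top hG.2).ne
  · rw [ENNReal.coe_toNNReal hCt]
    gcongr
    exact BoundaryForcing.lintegral_damp_sq_rpow_le_sobolevENorm hgG
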